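/- Let $G_1, G_2$ be separable (i.e. second countable) locally compact Hausdorff abelian groups whose Moore cohomology groups $H^3(G_j,\mathsf U(1))$ (Borel cochains, trivial action) are trivial, let $G=G_1\times G_2$, and let $A$ be a stable $C^*$-algebra with multiplier algebra $M(A)$. Lower case letters $x,y,z$ denote elements of $G_1$ and capitals $X,Y,Z$ elements of $G_2$, both regarded as elements of $G$. Let $\phi\colon G^3\to \mathsf U(1)$ be an antisymmetric tricharacter (a continuous character in each argument, inverted by each transposition of the arguments) which is identically $1$ on $G_1$ and is $1$ whenever two of its arguments lie in $G_2$. A (Borel) twisted action with three-cocycle $\varphi\colon G^3\to\mathsf U(1)$ is a pair $(\beta,v)$ of maps $\beta\colon G\to\mathrm{Aut}(A)$ and $v\colon G\times G\to \mathcal U(M(A))$, with $\xi\mapsto\beta_\xi(a)$, $(\xi,\eta)\mapsto v(\xi,\eta)a$ and $(\xi,\eta)\mapsto a\,v(\xi,\eta)$ strongly measurable for every $a\in A$, such that $$\beta_\xi\beta_\eta=\mathrm{ad}(v(\xi,\eta))\,\beta_{\xi\eta},\qquad v(\xi,\eta)v(\xi\eta,\zeta)=\varphi(\xi,\eta,\zeta)\,\beta_\xi[v(\eta,\zeta)]\,v(\xi,\eta\zeta).$$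 Two twisted actions $(\beta,v)$, $(\beta',v')$ are exterior equivalent if there are unitaries $w_\xi\in \mathcal U(M(A))$, with $\xi\mapsto w_\xi a$ and $\xi\mapsto a w_\xi$ strongly measurable for all $a\in A$, such that $\beta'_\xi=\mathrm{ad}(w_\xi)\beta_\xi$ and $v'(\xi,\eta)=w_\xi\beta_\xi[w_\eta]v(\xi,\eta)w_{\xi\eta}^{-1}$. They are exterior equivalent up to scalars if instead $v'(\xi,\eta)=c(\xi,\eta)\,w_\xi\beta_\xi[w_\eta]v(\xi,\eta)w_{\xi\eta}^{-1}$ for a Borel function $c\colon G\times G\to\mathsf U(1)$, and their three-cocycles are related by $\varphi'=\varphi\cdot dc$, where $(dc)(\xi,\eta,\zeta)=\dfrac{c(\xi,\eta)c(\xi\eta,\zeta)}{c(\xi,\eta\zeta)c(\eta,\zeta)}$. Let $(\beta,v)$ be a twisted action of $G$ on $A$ with three-cocycle $\phi$. Then: 1. We may take $v$ to be trivial on the subgroups $G_j$: $(\beta,v)$ is exterior equivalent to a twisted action $(\beta',v')$ with three-cocycle $\phi$ and $v'(x,y)=1$, $v'(X,Y)=1$ for all $x,y\in G_1$, $X,Y\in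 G_2$. 2. For every such $(\beta',v')$, set $\tilde v(X,y)=v'(X,y)v'(y,X)^{-1}$, $\hat\beta_{xX}=\beta'_x\beta'_X$ and $\hat v(xX,yY)=\beta'_x[\tilde v(X,y)]$. Then $(\hat\beta,\hat v)$ is a twisted action with three-cocycle $\hat\phi(xX,yY,zZ)=\phi(X,y,z)^3$; both $(\beta',v')$ and $(\beta,v)$ are exterior equivalent up to scalars to $(\hat\beta,\hat v)$; and $$\tilde v(XY,z)=\beta'_X[\tilde v(Y,z)]\,\tilde v(X,z),\qquad \tilde v(X,yz)=\phi(X,y,z)^{-3}\,\tilde v(X,y)\,\beta'_y[\tilde v(X,z)].$$ 3. The antisymmetrisation of $\hat\phi$ is $\phi$: for $\xi=xX$, $\eta=yY$, $\zeta=zZ$, $$\hat\phi(\xi,\eta,\zeta)\,\hat\phi(\eta,\zeta,\xi)\,\hat\phi(\zeta,\xi,\eta)=\phi(\xi,\eta,\zeta)^3,\qquad \phi(X,y,z)\,\phi(Y,z,x)\,\phi(Z,x,y)=\phi(\xi,\eta,\zeta).$$ -/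

import Mathlib

open MeasureTheory
open scoped MultiplierAlgebra

noncomputable section

namespace TwistedAction

/-! ### Multipliers and automorphisms of a C⋆-algebra -/

section Multiplier

variable {A : Type*} [NonUnitalCStarAlgebra A]

theorem eq_of_forall_mul_left {c d : A} (h : ∀ z : A, z * c = z * d) : c = d := by
  have h1 : star (c - d) * (c - d) = 0 := by rw [mul_sub, h, sub_self]
  exact sub_eq_zero.mp (CStarRing.star_mul_self_eq_zero_iff _ |>.mp h1)

theorem eq_of_forall_mul_right {c d : A} (h : ∀ z : A, c * z = d * z) : c = d := by
  have h1 : (c - d) * star (c - d) = 0 := by rw [sub_mul, h, sub_self]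
  exact sub_eq_zero.mp (CStarRing.mul_star_self_eq_zero_iff _ |>.mp h1)

/-- `m (a b) = (m a) b` for a multiplier `m`. -/
theorem fst_mul (m : 𝓜(ℂ, A)) (a b : A) : m.fst (a * b) = m.fst a * b :=
  eq_of_forall_mul_left fun z => by
    rw [← m.central, ← mul_assoc, ← mul_assoc, m.central]

/-- `(a b) m = a (b m)` for a multiplier `m`. -/
theorem snd_mul (m : 𝓜(ℂ, A)) (a b : A) : m.snd (a * b) = a * m.snd b :=
  eq_of_forall_mul_right fun z => by
    rw [m.central, mul_assoc, mul_assoc, m.central]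

/-- `m (a n) = (m a) n` for multipliers `m`, `n`. -/
theorem fst_snd (m n : 𝓜(ℂ, A)) (a : A) : m.fst (n.snd a) = n.snd (m.fst a) :=
  eq_of_forall_mul_left fun z => by
    rw [← m.central, ← snd_mul, ← snd_mul, m.central]

theorem fst_star_mul_cancel (u : unitary 𝓜(ℂ, A)) (a : A) :
    (star (u : 𝓜(ℂ, A))).fst ((u : 𝓜(ℂ, A)).fst a) = a := by
  exact congrArg (fun m : 𝓜(ℂ, A) => m.fst a) (Unitary.coe_star_mul_self u)

theorem fst_mul_star_cancel (u : unitary 𝓜(ℂ, A)) (a : A) :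
    (u : 𝓜(ℂ, A)).fst ((star (u : 𝓜(ℂ, A))).fst a) = a := by
  exact congrArg (fun m : 𝓜(ℂ, A) => m.fst a) (Unitary.coe_mul_star_self u)

theorem snd_star_mul_cancel (u : unitary 𝓜(ℂ, A)) (a : A) :
    (u : 𝓜(ℂ, A)).snd ((star (u : 𝓜(ℂ, A))).snd a) = a := by
  exact congrArg (fun m : 𝓜(ℂ, A) => m.snd a) (Unitary.coe_star_mul_self u)

theorem snd_mul_star_cancel (u : unitary 𝓜(ℂ, A)) (a : A) :
    (star (u : 𝓜(ℂ, A))).snd ((u : 𝓜(ℂ, A)).snd a) = a := by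
  exact congrArg (fun m : 𝓜(ℂ, A) => m.snd a) (Unitary.coe_mul_star_self u)

/-- The automorphism `ad(u) : a ↦ u a u⁻¹` of `A` given by a unitary multiplier `u`. Here
`m.fst a` and `m.snd a` are the products `m a` and `a m` of `a : A` with a multiplier `m`. -/
def ad (u : unitary 𝓜(ℂ, A)) : A ≃⋆ₐ[ℂ] A where
  toFun a := (u : 𝓜(ℂ, A)).fst ((star (u : 𝓜(ℂ, A))).snd a)
  invFun a := (star (u : 𝓜(ℂ, A))).fst ((u : 𝓜(ℂ, A)).snd a)
  left_inv a := by
    beta_reduce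
    rw [← fst_snd (u : 𝓜(ℂ, A)) (u : 𝓜(ℂ, A)), fst_star_mul_cancel, snd_star_mul_cancel]
  right_inv a := by
    beta_reduce
    rw [← fst_snd (star (u : 𝓜(ℂ, A))) (star (u : 𝓜(ℂ, A))), fst_mul_star_cancel,
      snd_mul_star_cancel]
  map_mul' a b := by
    have h : (star (u : 𝓜(ℂ, A))).snd a * (u : 𝓜(ℂ, A)).fst ((star (u : 𝓜(ℂ, A))).snd b)
        = (star (u : 𝓜(ℂ, A))).snd (a * b) := by
      rw [← (u : 𝓜(ℂ, A)).central, snd_star_mul_cancel, snd_mul]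
    rw [← fst_mul, h]
  map_add' a b := by simp only [map_add]
  map_smul' c a := by simp only [map_smul]
  map_star' a := by
    rw [fst_snd, DoubleCentralizer.star_snd, DoubleCentralizer.star_snd]

/-- An automorphism of a C⋆-algebra as a continuous linear map. -/
def autCLM (β : A ≃⋆ₐ[ℂ] A) : A →L[ℂ] A where
  toFun a := β a
  map_add' a b := map_add β a b
  map_smul' c a := map_smul β c a
  cont := (NonUnitalStarAlgHom.isometry β β.injective).continuous

@[simp]
theorem autCLM_apply (β : A ≃⋆ₐ[ℂ] A) (a : A) : autCLM β a = β a := rfl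

/-- The canonical extension of an automorphism `β` of `A` to the multiplier algebra, determined by
`β(m) β(a) = β(m a)` and `β(a) β(m) = β(a m)`. -/
def extend (β : A ≃⋆ₐ[ℂ] A) : 𝓜(ℂ, A) →⋆ₐ[ℂ] 𝓜(ℂ, A) where
  toFun m :=
    { fst := (autCLM β).comp (m.fst.comp (autCLM β.symm))
      snd := (autCLM β).comp (m.snd.comp (autCLM β.symm))
      central := fun x y => by
        have h := congrArg β (m.central (β.symm x) (β.symm y))
        simpa using h }
  map_one' := by
    ext a <;> simp
  map_mul' m n := by
    ext a <;> simp
  map_zero' := by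
    ext a <;> simp
  map_add' m n := by
    ext a <;> simp
  commutes' c := by
    ext a <;> simp [Algebra.algebraMap_eq_smul_one]
  map_star' m := by
    ext a <;> simp [map_star]

/-- The action of an automorphism of `A` on the unitary group of the multiplier algebra. -/
def onUnitary (β : A ≃⋆ₐ[ℂ] A) : unitary 𝓜(ℂ, A) →⋆* unitary 𝓜(ℂ, A) :=
  Unitary.map
    { toFun := extend β
      map_one' := map_one (extend β)
      map_mul' := map_mul (extend β)
      map_star' := map_star (extend β) }

/-- A family of unitary multipliers is strictly (strongly) measurable if its products with every
element of `A`, on the left and on the right, are strongly measurable. For separable `A` this is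
Borel measurability for the strict topology. -/
def StrictlyMeasurable {S : Type*} [MeasurableSpace S] (u : S → unitary 𝓜(ℂ, A)) : Prop :=
  ∀ a : A, StronglyMeasurable (fun s => (u s : 𝓜(ℂ, A)).fst a) ∧
    StronglyMeasurable (fun s => (u s : 𝓜(ℂ, A)).snd a)

variable (A) in
/-- `A` is stable, `A ≅ A ⊗ 𝒦(ℓ²(ℕ))`. The C⋆-algebra `A ⊗ 𝒦` is the completion of the
⋆-algebra of finitely supported matrices `∑ aᵢⱼ ⊗ eᵢⱼ` over `A` in its unique C⋆-norm, so an
isomorphism `A ⊗ 𝒦 ≅ A` is the same as an injective ⋆-homomorphism from that ⋆-algebra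
to `A` with dense range; `e i j a` is the image of `a ⊗ eᵢⱼ`. -/
def IsStable : Prop :=
  ∃ e : ℕ → ℕ → A →ₗ[ℂ] A,
    (∀ i j k l a b, e i j a * e k l b = if j = k then e i l (a * b) else 0) ∧
    (∀ i j a, star (e i j a) = e j i (star a)) ∧
    (∀ i j, Function.Injective (e i j)) ∧
    Dense ((⨆ i, ⨆ j, LinearMap.range (e i j) : Submodule ℂ A) : Set A)

end Multiplier

/-! ### `U(1)`-valued cochains -/

section Cochains

variable {G : Type*} [CommGroup G]

/-- The coboundary `(dc)(x,y,z) = c(x,y) c(xy,z) / (c(x,yz) c(y,z))` of a `U(1)`-valued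
two-cochain. -/
def coboundary (c : G → G → Circle) (x y z : G) : Circle :=
  c x y * c (x * y) z / (c x (y * z) * c y z)

/-- The three-cocycle (pentagon) identity, for the trivial action on `U(1)`. -/
def IsThreeCocycle (f : G → G → G → Circle) : Prop :=
  ∀ x y z t, f y z t * f x (y * z) t * f x y z = f (x * y) z t * f x y (z * t)

variable (G) in
/-- The Moore cohomology group `H³(G, U(1))` (cohomology of the complex of Borel cochains, with
trivial action on `U(1)`) is trivial: each Borel three-cocycle is the coboundary of a Borel
two-cochain. -/
def MooreH3Trivial [MeasurableSpace G] : Prop :=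
  ∀ f : G → G → G → Circle, Measurable (fun p : G × G × G => (f p.1 p.2.1 p.2.2 : ℂ)) →
    IsThreeCocycle f →
      ∃ c : G → G → Circle, Measurable (fun p : G × G => (c p.1 p.2 : ℂ)) ∧
        ∀ x y z, f x y z = coboundary c x y z

/-- Antisymmetric tricharacters: (continuous) characters in each argument, inverted by every
transposition of the arguments. -/
structure IsAntisymmTricharacter [TopologicalSpace G] (φ : G → G → G → Circle) : Prop where
  map_mul₁ : ∀ x x' y z, φ (x * x') y z = φ x y z * φ x' y z
  map_mul₂ : ∀ x y y' z, φ x (y * y') z = φ x y z * φ x y' z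
  map_mul₃ : ∀ x y z z', φ x y (z * z') = φ x y z * φ x y z'
  continuous₁ : ∀ y z, Continuous fun x => φ x y z
  continuous₂ : ∀ x z, Continuous fun y => φ x y z
  continuous₃ : ∀ x y, Continuous fun z => φ x y z
  swap₁₂ : ∀ x y z, φ y x z = (φ x y z)⁻¹
  swap₂₃ : ∀ x y z, φ x z y = (φ x y z)⁻¹
  swap₁₃ : ∀ x y z, φ z y x = (φ x y z)⁻¹

end Cochains

/-! ### Twisted actions and exterior equivalence -/

section Actions

variable {G A : Type*} [CommGroup G] [MeasurableSpace G] [NonUnitalCStarAlgebra A]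

/-- `β : G → Aut(A)` is a (Borel) twisted homomorphism with unitary multiplier-valued twisting `v`
and three-cocycle `φ`. -/
structure IsTwistedAction (β : G → (A ≃⋆ₐ[ℂ] A)) (v : G → G → unitary 𝓜(ℂ, A))
    (φ : G → G → G → Circle) : Prop where
  measurable_action : ∀ a : A, StronglyMeasurable fun x => β x a
  measurable_twist : StrictlyMeasurable fun p : G × G => v p.1 p.2
  comp : ∀ x y, β x * β y = ad (v x y) * β (x * y)
  cocycle : ∀ x y z, ((v x y * v (x * y) z : unitary 𝓜(ℂ, A)) : 𝓜(ℂ, A)) =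
    (φ x y z : ℂ) • ((onUnitary (β x) (v y z) * v x (y * z) : unitary 𝓜(ℂ, A)) : 𝓜(ℂ, A))

/-- Exterior equivalence of `(β, v)` with `(β', v')`:
`β'_x = ad(w_x) β_x` and `v'(x,y) = w_x β_x(w_y) v(x,y) w_{xy}⁻¹`. -/
def ExteriorEquivalent (β : G → (A ≃⋆ₐ[ℂ] A)) (v : G → G → unitary 𝓜(ℂ, A))
    (β' : G → (A ≃⋆ₐ[ℂ] A)) (v' : G → G → unitary 𝓜(ℂ, A)) : Prop :=
  ∃ w : G → unitary 𝓜(ℂ, A), StrictlyMeasurable w ∧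
    (∀ x, β' x = ad (w x) * β x) ∧
    ∀ x y, v' x y = w x * onUnitary (β x) (w y) * v x y * (w (x * y))⁻¹

/-- Exterior equivalence up to scalars of `(β, v)`, with three-cocycle `φ`, and `(β', v')`, with
three-cocycle `φ'`: for some Borel two-cochain `c` with values in `U(1)`,
`β'_x = ad(w_x) β_x`, `v'(x,y) = c(x,y) w_x β_x(w_y) v(x,y) w_{xy}⁻¹` and `φ' = φ · dc`. -/
def ExteriorEquivalentUpToScalars (β : G → (A ≃⋆ₐ[ℂ] A)) (v : G → G → unitary 𝓜(ℂ, A))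
    (φ : G → G → G → Circle) (β' : G → (A ≃⋆ₐ[ℂ] A)) (v' : G → G → unitary 𝓜(ℂ, A))
    (φ' : G → G → G → Circle) : Prop :=
  ∃ (w : G → unitary 𝓜(ℂ, A)) (c : G → G → Circle), StrictlyMeasurable w ∧
    Measurable (fun p : G × G => (c p.1 p.2 : ℂ)) ∧
    (∀ x, β' x = ad (w x) * β x) ∧
    (∀ x y, (v' x y : 𝓜(ℂ, A)) = (c x y : ℂ) •
      ((w x * onUnitary (β x) (w y) * v x y * (w (x * y))⁻¹ : unitary 𝓜(ℂ, A)) : 𝓜(ℂ, A))) ∧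
    ∀ x y z, φ' x y z = φ x y z * coboundary c x y z

end Actions

/-! ### Actions of a product group -/

section Product

variable {G₁ G₂ A : Type*} [CommGroup G₁] [CommGroup G₂] [NonUnitalCStarAlgebra A]

/-- `v` is trivial on each of the subgroups `G₁` and `G₂` of `G₁ × G₂`. -/
def TrivialOnFactors (v : G₁ × G₂ → G₁ × G₂ → unitary 𝓜(ℂ, A)) : Prop :=
  (∀ x y : G₁, v (x, 1) (y, 1) = 1) ∧ ∀ X Y : G₂, v (1, X) (1, Y) = 1

/-- `β̂_{xX} = β_x β_X`. -/
def hatAction (β : G₁ × G₂ → (A ≃⋆ₐ[ℂ] A)) (ξ : G₁ × G₂) : A ≃⋆ₐ[ℂ] A :=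
  β (ξ.1, 1) * β (1, ξ.2)

/-- `ṽ(X, y) = v(X, y) v(y, X)⁻¹`. -/
def tildeTwist (v : G₁ × G₂ → G₁ × G₂ → unitary 𝓜(ℂ, A)) (X : G₂) (y : G₁) :
    unitary 𝓜(ℂ, A) :=
  v (1, X) (y, 1) * (v (y, 1) (1, X))⁻¹

/-- `v̂(xX, yY) = β_x[ṽ(X, y)]`. -/
def hatTwist (β : G₁ × G₂ → (A ≃⋆ₐ[ℂ] A)) (v : G₁ × G₂ → G₁ × G₂ → unitary 𝓜(ℂ, A))
    (ξ η : G₁ × G₂) : unitary 𝓜(ℂ, A) :=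
  onUnitary (β (ξ.1, 1)) (tildeTwist v ξ.2 η.1)

/-- `φ̂(xX, yY, zZ) = φ(X, y, z)³`. -/
def hatCocycle (φ : G₁ × G₂ → G₁ × G₂ → G₁ × G₂ → Circle) (ξ η ζ : G₁ × G₂) : Circle :=
  φ (1, ξ.2) (η.1, 1) (ζ.1, 1) ^ 3

end Product

end TwistedAction

end

open TwistedAction

/-!
A twisted action `(β, v)` with trivial three-cocycle acts on `L²(G; A)` by the twisted regular
representation `(W_x g)(t) = v(x, x⁻¹t)⁻¹ β_x(g(x⁻¹t))`, in which `W_x W_y` is `W_{xy}` followed by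
right multiplication by `v(x, y)⁻¹`. Stability of `A` makes the Hilbert module `L²(G; A)` isomorphic
to `A` itself. Carried over to `A`, each `W_x` becomes `w_x β_x` for a unitary multiplier `w_x`, and
the composition rule says that `w` untwists `v`. Applied to `G₁` and `G₂`, on both of which `φ` is
trivial, this gives the first claim.

When `v` is trivial on both factors, `β̂_{xX} = β_x β_X` is the perturbation of `β` by the unitaries
`w_{xX} = v(x, X)`. Three instances of the cocycle identity show that the perturbed twisting is `v̂`
up to a scalar two-cochain `c`, and multiplicativity and antisymmetry of `φ` give `φ̂ = φ · dc`. The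
relations for `ṽ` are the cocycle identity of `(β̂, v̂)` on elements of the two factors.
-/

noncomputable section

namespace TwistedAction

/-! ### Unitary multipliers -/

section Unitaries

variable {A : Type*} [NonUnitalCStarAlgebra A]

theorem norm_eq_norm_of_star_mul_self_eq {a b : A} (h : star a * a = star b * b) : ‖a‖ = ‖b‖ := by
  rw [← mul_self_inj (norm_nonneg _) (norm_nonneg _), ← CStarRing.norm_star_mul_self, h,
    CStarRing.norm_star_mul_self]

theorem multiplier_ext {m n : 𝓜(ℂ, A)} (h : ∀ a, m.fst a = n.fst a) : m = n := by
  refine DoubleCentralizer.ext _ _ _ _ (Prod.ext (ContinuousLinearMap.ext h)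
    (ContinuousLinearMap.ext fun a => eq_of_forall_mul_right fun z => ?_))
  exact (m.central a z).trans ((congrArg (a * ·) (h z)).trans (n.central a z).symm)

theorem unitary_ext {u w : unitary 𝓜(ℂ, A)}
    (h : ∀ a, (u : 𝓜(ℂ, A)).fst a = (w : 𝓜(ℂ, A)).fst a) : u = w :=
  Subtype.ext (multiplier_ext h)

theorem coe_mul_fst (u w : unitary 𝓜(ℂ, A)) (a : A) :
    ((u * w : unitary 𝓜(ℂ, A)) : 𝓜(ℂ, A)).fst a = (u : 𝓜(ℂ, A)).fst ((w : 𝓜(ℂ, A)).fst a) := rfl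

theorem coe_inv_eq_star (u : unitary 𝓜(ℂ, A)) :
    ((u⁻¹ : unitary 𝓜(ℂ, A)) : 𝓜(ℂ, A)) = star (u : 𝓜(ℂ, A)) := rfl

theorem star_fst_mul_fst (u : unitary 𝓜(ℂ, A)) (a b : A) :
    star ((u : 𝓜(ℂ, A)).fst a) * (u : 𝓜(ℂ, A)).fst b = star a * b := by
  have h := (star (u : 𝓜(ℂ, A))).central (star a) ((u : 𝓜(ℂ, A)).fst b)
  rwa [fst_star_mul_cancel, DoubleCentralizer.star_snd, star_star] at h

theorem norm_fst_apply (u : unitary 𝓜(ℂ, A)) (a : A) : ‖(u : 𝓜(ℂ, A)).fst a‖ = ‖a‖ :=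
  norm_eq_norm_of_star_mul_self_eq (star_fst_mul_fst u a a)

theorem onUnitary_fst (β : A ≃⋆ₐ[ℂ] A) (u : unitary 𝓜(ℂ, A)) (a : A) :
    (onUnitary β u : 𝓜(ℂ, A)).fst a = β ((u : 𝓜(ℂ, A)).fst (β.symm a)) := rfl

theorem onUnitary_snd (β : A ≃⋆ₐ[ℂ] A) (u : unitary 𝓜(ℂ, A)) (a : A) :
    (onUnitary β u : 𝓜(ℂ, A)).snd a = β ((u : 𝓜(ℂ, A)).snd (β.symm a)) := rfl

theorem map_fst (β : A ≃⋆ₐ[ℂ] A) (u : unitary 𝓜(ℂ, A)) (a : A) :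
    β ((u : 𝓜(ℂ, A)).fst a) = (onUnitary β u : 𝓜(ℂ, A)).fst (β a) := by
  rw [onUnitary_fst, StarAlgEquiv.symm_apply_apply]

theorem map_snd (β : A ≃⋆ₐ[ℂ] A) (u : unitary 𝓜(ℂ, A)) (a : A) :
    β ((u : 𝓜(ℂ, A)).snd a) = (onUnitary β u : 𝓜(ℂ, A)).snd (β a) := by
  rw [onUnitary_snd, StarAlgEquiv.symm_apply_apply]

@[simp]
theorem onUnitary_one_aut (u : unitary 𝓜(ℂ, A)) : onUnitary (1 : A ≃⋆ₐ[ℂ] A) u = u :=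
  unitary_ext fun _ => rfl

theorem onUnitary_mul_aut (β γ : A ≃⋆ₐ[ℂ] A) (u : unitary 𝓜(ℂ, A)) :
    onUnitary (β * γ) u = onUnitary β (onUnitary γ u) :=
  unitary_ext fun _ => rfl

theorem ad_apply (u : unitary 𝓜(ℂ, A)) (a : A) :
    ad u a = (u : 𝓜(ℂ, A)).fst ((star (u : 𝓜(ℂ, A))).snd a) := rfl

@[simp]
theorem ad_one : ad (1 : unitary 𝓜(ℂ, A)) = 1 := by
  ext a
  simp [ad_apply]

theorem ad_mul (u w : unitary 𝓜(ℂ, A)) : ad (u * w) = ad u * ad w := by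
  ext a
  change (u : 𝓜(ℂ, A)).fst ((w : 𝓜(ℂ, A)).fst ((star ((u : 𝓜(ℂ, A)) * (w : 𝓜(ℂ, A)))).snd a)) =
    (u : 𝓜(ℂ, A)).fst ((star (u : 𝓜(ℂ, A))).snd
      ((w : 𝓜(ℂ, A)).fst ((star (w : 𝓜(ℂ, A))).snd a)))
  rw [star_mul, DoubleCentralizer.mul_snd, ← fst_snd, mul_apply_eq_comp]

@[simp]
theorem ad_inv (u : unitary 𝓜(ℂ, A)) : ad u⁻¹ = (ad u)⁻¹ := by
  rw [eq_inv_iff_mul_eq_one, ← ad_mul, inv_mul_cancel, ad_one]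

theorem aut_mul_ad (β : A ≃⋆ₐ[ℂ] A) (u : unitary 𝓜(ℂ, A)) :
    β * ad u = ad (onUnitary β u) * β := by
  ext a
  change β (ad u a) = ad (onUnitary β u) (β a)
  rw [ad_apply, ad_apply, map_fst, ← coe_inv_eq_star, ← coe_inv_eq_star, map_snd, map_inv]

theorem onUnitary_ad (u m : unitary 𝓜(ℂ, A)) : onUnitary (ad u) m = u * m * u⁻¹ := by
  refine unitary_ext fun a => ?_
  change (u : 𝓜(ℂ, A)).fst ((star (u : 𝓜(ℂ, A))).snd ((m : 𝓜(ℂ, A)).fst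
      ((star (u : 𝓜(ℂ, A))).fst ((u : 𝓜(ℂ, A)).snd a)))) =
    (u : 𝓜(ℂ, A)).fst ((m : 𝓜(ℂ, A)).fst ((star (u : 𝓜(ℂ, A))).fst a))
  rw [← fst_snd, ← fst_snd, snd_mul_star_cancel]

/-- The scalars of modulus one as central unitary multipliers, so that the scalar factors in the
cocycle identities can be manipulated inside the group of unitaries. -/
def scalar : Circle →* unitary 𝓜(ℂ, A) where
  toFun c := ⟨algebraMap ℂ 𝓜(ℂ, A) c, by
    have h : star (c : ℂ) * c = 1 := by
      rw [mul_comm, Complex.star_def, Complex.mul_conj, Circle.normSq_coe, Complex.ofReal_one]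
    rw [Unitary.mem_iff, ← algebraMap_star_comm, ← map_mul, ← map_mul]
    exact ⟨by rw [h, map_one], by rw [mul_comm, h, map_one]⟩⟩
  map_one' := Subtype.ext (by simp)
  map_mul' c d := Subtype.ext (by simp)

theorem eq_scalar_mul_iff {c : Circle} {u w : unitary 𝓜(ℂ, A)} :
    u = scalar c * w ↔ (u : 𝓜(ℂ, A)) = (c : ℂ) • (w : 𝓜(ℂ, A)) := by
  rw [Subtype.ext_iff, Algebra.smul_def]
  rfl

theorem scalar_comm (c : Circle) (u : unitary 𝓜(ℂ, A)) : scalar c * u = u * scalar c :=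
  Subtype.ext (Algebra.commutes _ _)

theorem mul_scalar_mul (c : Circle) (u w : unitary 𝓜(ℂ, A)) :
    u * (scalar c * w) = scalar c * (u * w) := by
  rw [← mul_assoc, ← scalar_comm, mul_assoc]

theorem scalar_mul_mul_scalar_mul (c d : Circle) (u w : unitary 𝓜(ℂ, A)) :
    scalar c * u * (scalar d * w) = scalar (c * d) * (u * w) := by
  rw [mul_scalar_mul, mul_assoc, ← mul_assoc (scalar d), ← map_mul, mul_comm d]

@[simp]
theorem onUnitary_scalar (β : A ≃⋆ₐ[ℂ] A) (c : Circle) : onUnitary β (scalar c) = scalar c :=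
  Subtype.ext ((extend β).commutes' c)

@[simp]
theorem ad_scalar (c : Circle) : ad (scalar c : unitary 𝓜(ℂ, A)) = 1 := by
  ext a
  rw [ad_apply, ← coe_inv_eq_star, ← map_inv]
  change (c : ℂ) • ((c⁻¹ : Circle) : ℂ) • a = a
  rw [smul_smul, ← Circle.coe_mul, mul_inv_cancel, Circle.coe_one, one_smul]

end Unitaries

/-! ### Measurability of families of multipliers -/

section Measurability

variable {S : Type*} [MeasurableSpace S]

theorem stronglyMeasurable_apply {E F : Type*} [TopologicalSpace E] [TopologicalSpace F]
    [TopologicalSpace.PseudoMetrizableSpace F] {u : S → E → F} (hu : ∀ s, Continuous (u s))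
    (hmeas : ∀ a, StronglyMeasurable fun s => u s a) {f : S → E} (hf : StronglyMeasurable f) :
    StronglyMeasurable fun s => u s (f s) := by
  have simple (g : SimpleFunc S E) : StronglyMeasurable fun s => u s (g s) :=
    ⟨fun n => g.bind fun a => (hmeas a).approx n, fun s => (hmeas (g s)).tendsto_approx s⟩
  exact stronglyMeasurable_of_tendsto Filter.atTop (fun n => simple (hf.approx n))
    (tendsto_pi_nhds.2 fun s => ((hu s).tendsto _).comp (hf.tendsto_approx s))

variable {A : Type*} [NonUnitalCStarAlgebra A]

theorem stronglyMeasurable_aut_apply {β : S → (A ≃⋆ₐ[ℂ] A)}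
    (hβ : ∀ a, StronglyMeasurable fun s => β s a) {f : S → A} (hf : StronglyMeasurable f) :
    StronglyMeasurable fun s => β s (f s) :=
  stronglyMeasurable_apply (fun s => (autCLM (β s)).continuous) hβ hf

theorem strictlyMeasurable_of_fst {u : S → unitary 𝓜(ℂ, A)}
    (h : ∀ a, StronglyMeasurable fun s => (u s : 𝓜(ℂ, A)).fst a)
    (h_inv : ∀ a, StronglyMeasurable fun s => (((u s)⁻¹ : unitary 𝓜(ℂ, A)) : 𝓜(ℂ, A)).fst a) :
    StrictlyMeasurable u := by
  refine fun a => ⟨h a, ?_⟩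
  have h_star : StronglyMeasurable fun s => star ((u s : 𝓜(ℂ, A)).snd a) := by
    simpa only [coe_inv_eq_star, DoubleCentralizer.star_fst, star_star] using h_inv (star a)
  simpa only [Pi.star_def, star_star] using h_star.star

namespace StrictlyMeasurable

variable {u w : S → unitary 𝓜(ℂ, A)}

theorem fst_apply (hu : StrictlyMeasurable u) {f : S → A} (hf : StronglyMeasurable f) :
    StronglyMeasurable fun s => (u s : 𝓜(ℂ, A)).fst (f s) :=
  stronglyMeasurable_apply (fun s => (u s : 𝓜(ℂ, A)).fst.continuous) (fun a => (hu a).1) hf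

theorem snd_apply (hu : StrictlyMeasurable u) {f : S → A} (hf : StronglyMeasurable f) :
    StronglyMeasurable fun s => (u s : 𝓜(ℂ, A)).snd (f s) :=
  stronglyMeasurable_apply (fun s => (u s : 𝓜(ℂ, A)).snd.continuous) (fun a => (hu a).2) hf

theorem const (u : unitary 𝓜(ℂ, A)) : StrictlyMeasurable fun _ : S => u :=
  fun _ => ⟨stronglyMeasurable_const, stronglyMeasurable_const⟩

theorem mul (hu : StrictlyMeasurable u) (hw : StrictlyMeasurable w) :
    StrictlyMeasurable fun s => u s * w s :=
  fun a => ⟨hu.fst_apply (hw a).1, hw.snd_apply (hu a).2⟩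

theorem inv (hu : StrictlyMeasurable u) : StrictlyMeasurable fun s => (u s)⁻¹ := by
  refine fun a => ⟨?_, ?_⟩
  · simp only [coe_inv_eq_star, DoubleCentralizer.star_fst]
    exact (hu _).2.star
  · simp only [coe_inv_eq_star, DoubleCentralizer.star_snd]
    exact (hu _).1.star

theorem comp (hu : StrictlyMeasurable u) {R : Type*} [MeasurableSpace R] {g : R → S}
    (hg : Measurable g) : StrictlyMeasurable fun r => u (g r) :=
  fun a => ⟨(hu a).1.comp_measurable hg, (hu a).2.comp_measurable hg⟩

theorem scalar {c : S → Circle} (hc : Measurable fun s => (c s : ℂ)) :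
    StrictlyMeasurable fun s => (scalar (c s) : unitary 𝓜(ℂ, A)) :=
  fun a => ⟨hc.stronglyMeasurable.smul_const a, hc.stronglyMeasurable.smul_const a⟩

theorem ad_apply (hu : StrictlyMeasurable u) {f : S → A} (hf : StronglyMeasurable f) :
    StronglyMeasurable fun s => ad (u s) (f s) :=
  hu.fst_apply (hu.inv.snd_apply hf)

theorem onUnitary (hu : StrictlyMeasurable u) {β : S → (A ≃⋆ₐ[ℂ] A)}
    (hβ : ∀ a, StronglyMeasurable fun s => β s a)
    (hβ_symm : ∀ a, StronglyMeasurable fun s => (β s).symm a) :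
    StrictlyMeasurable fun s => onUnitary (β s) (u s) :=
  fun a => ⟨stronglyMeasurable_aut_apply hβ (hu.fst_apply (hβ_symm a)),
    stronglyMeasurable_aut_apply hβ (hu.snd_apply (hβ_symm a))⟩

end StrictlyMeasurable

end Measurability

/-! ### Exterior equivalence -/

namespace IsTwistedAction

variable {G A : Type*} [CommGroup G] [MeasurableSpace G] [NonUnitalCStarAlgebra A]
  {β : G → (A ≃⋆ₐ[ℂ] A)} {v : G → G → unitary 𝓜(ℂ, A)} {φ : G → G → G → Circle}

theorem onUnitary_comp (h : IsTwistedAction β v φ) (x y : G) (m : unitary 𝓜(ℂ, A)) :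
    onUnitary (β x) (onUnitary (β y) m) = v x y * onUnitary (β (x * y)) m * (v x y)⁻¹ := by
  rw [← onUnitary_mul_aut, h.comp, onUnitary_mul_aut, onUnitary_ad]

theorem cocycle_eq (h : IsTwistedAction β v φ) (x y z : G) :
    v x y * v (x * y) z = scalar (φ x y z) * (onUnitary (β x) (v y z) * v x (y * z)) :=
  eq_scalar_mul_iff.2 (h.cocycle x y z)

theorem mul_onUnitary_mul (h : IsTwistedAction β v φ) (x y z : G) (m : unitary 𝓜(ℂ, A)) :
    v x y * onUnitary (β (x * y)) m * v (x * y) z =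
      scalar (φ x y z) * (onUnitary (β x) (onUnitary (β y) m * v y z) * v x (y * z)) := by
  calc v x y * onUnitary (β (x * y)) m * v (x * y) z
      = onUnitary (β x) (onUnitary (β y) m) * (v x y * v (x * y) z) := by
        rw [h.onUnitary_comp]; group
    _ = _ := by rw [h.cocycle_eq, mul_scalar_mul, map_mul, mul_assoc (onUnitary (β x) _)]

theorem action_one (h : IsTwistedAction β v φ) : β 1 = ad (v 1 1) :=
  mul_right_cancel (by simpa only [mul_one] using h.comp 1 1)

theorem inv_action (h : IsTwistedAction β v φ) (x : G) :
    (β x)⁻¹ = β x⁻¹ * ad (v 1 1)⁻¹ * ad (v x x⁻¹)⁻¹ := by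
  rw [inv_eq_iff_mul_eq_one, ← mul_assoc, ← mul_assoc, h.comp, mul_inv_cancel, h.action_one]
  simp

theorem measurable_symm [MeasurableInv G] (h : IsTwistedAction β v φ) (a : A) :
    StronglyMeasurable fun x => (β x).symm a := by
  have hsymm : (fun x => (β x).symm a) =
      fun x => β x⁻¹ (ad (v 1 1)⁻¹ (ad (v x x⁻¹)⁻¹ a)) :=
    funext fun x => DFunLike.congr_fun (h.inv_action x) a
  have hv : StrictlyMeasurable fun x => (v x x⁻¹)⁻¹ :=
    (h.measurable_twist.comp (g := fun x => (x, x⁻¹)) (by fun_prop)).inv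
  rw [hsymm]
  exact stronglyMeasurable_aut_apply
    (fun b => (h.measurable_action b).comp_measurable measurable_inv)
    ((StrictlyMeasurable.const (v 1 1)⁻¹).ad_apply (hv.ad_apply stronglyMeasurable_const))

theorem scalar_mul (h : IsTwistedAction β v φ) {c : G → G → Circle}
    (hc : Measurable fun p : G × G => (c p.1 p.2 : ℂ)) :
    IsTwistedAction β (fun x y => scalar (c x y) * v x y)
      (fun x y z => φ x y z * coboundary c x y z) where
  measurable_action := h.measurable_action
  measurable_twist := (StrictlyMeasurable.scalar hc).mul h.measurable_twist
  comp x y := by rw [ad_mul, ad_scalar, one_mul, h.comp]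
  cocycle x y z := by
    have hcoboundary : c x y * c (x * y) z * φ x y z =
        φ x y z * coboundary c x y z * (c y z * c x (y * z)) := by
      rw [coboundary, mul_comm (c y z), mul_assoc (φ x y z), div_mul_cancel, mul_comm]
    rw [← eq_scalar_mul_iff, map_mul (onUnitary (β x)), onUnitary_scalar,
      scalar_mul_mul_scalar_mul, scalar_mul_mul_scalar_mul, h.cocycle_eq,
      ← mul_assoc (scalar _) (scalar _), ← mul_assoc (scalar _) (scalar _), ← map_mul, ← map_mul,
      hcoboundary]

theorem comp_hom {H : Type*} [CommGroup H] [MeasurableSpace H] (h : IsTwistedAction β v φ)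
    (f : H →* G) (hf : Measurable f) :
    IsTwistedAction (fun x => β (f x)) (fun x y => v (f x) (f y))
      (fun x y z => φ (f x) (f y) (f z)) where
  measurable_action a := (h.measurable_action a).comp_measurable hf
  measurable_twist := h.measurable_twist.comp (g := fun p : H × H => (f p.1, f p.2))
    ((hf.comp measurable_fst).prodMk (hf.comp measurable_snd))
  comp x y := by rw [map_mul, h.comp]
  cocycle x y z := by rw [map_mul, map_mul, h.cocycle]

end IsTwistedAction

section ExteriorEquivalence

variable {G A : Type*} [CommGroup G] [MeasurableSpace G] [NonUnitalCStarAlgebra A]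
  {β β' : G → (A ≃⋆ₐ[ℂ] A)} {v v' : G → G → unitary 𝓜(ℂ, A)} {φ φ' : G → G → G → Circle}

theorem ExteriorEquivalent.isTwistedAction [MeasurableInv G] [MeasurableMul₂ G]
    (e : ExteriorEquivalent β v β' v') (h : IsTwistedAction β v φ) : IsTwistedAction β' v' φ := by
  obtain ⟨w, hw, hβ', hv'⟩ := e
  obtain rfl : β' = fun x => ad (w x) * β x := funext hβ'
  obtain rfl : v' = fun x y => w x * onUnitary (β x) (w y) * v x y * (w (x * y))⁻¹ :=
    funext₂ hv'
  refine ⟨fun a => hw.ad_apply (h.measurable_action a), ?_, fun x y => ?_, fun x y z => ?_⟩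
  · have hβw : StrictlyMeasurable fun p : G × G => onUnitary (β p.1) (w p.2) :=
      (hw.comp measurable_snd).onUnitary
        (fun a => (h.measurable_action a).comp_measurable measurable_fst)
        (fun a => (h.measurable_symm a).comp_measurable measurable_fst)
    exact (((hw.comp measurable_fst).mul hβw).mul h.measurable_twist).mul
      (hw.comp (measurable_fst.mul measurable_snd)).inv
  · calc ad (w x) * β x * (ad (w y) * β y)
        = ad (w x) * (β x * ad (w y)) * β y := by group
      _ = ad (w x) * ad (onUnitary (β x) (w y)) * (β x * β y) := by rw [aut_mul_ad]; group
      _ = _ := by rw [h.comp]; simp only [ad_mul, ad_inv]; group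
  · rw [← eq_scalar_mul_iff, onUnitary_mul_aut, onUnitary_ad]
    calc w x * onUnitary (β x) (w y) * v x y * (w (x * y))⁻¹ *
          (w (x * y) * onUnitary (β (x * y)) (w z) * v (x * y) z * (w (x * y * z))⁻¹)
        = w x * onUnitary (β x) (w y) * (v x y * onUnitary (β (x * y)) (w z) * v (x * y) z) *
            (w (x * (y * z)))⁻¹ := by rw [mul_assoc x]; group
      _ = scalar (φ x y z) * (w x * onUnitary (β x) (w y) *
            (onUnitary (β x) (onUnitary (β y) (w z) * v y z) * v x (y * z)) *
              (w (x * (y * z)))⁻¹) := by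
          rw [h.mul_onUnitary_mul, mul_scalar_mul, mul_assoc (scalar _)]
      _ = _ := by simp only [map_mul (onUnitary (β x)), map_inv (onUnitary (β x))]; group

theorem ExteriorEquivalentUpToScalars.isTwistedAction [MeasurableInv G] [MeasurableMul₂ G]
    (e : ExteriorEquivalentUpToScalars β v φ β' v' φ') (h : IsTwistedAction β v φ) :
    IsTwistedAction β' v' φ' := by
  obtain ⟨w, c, hw, hc, hβ', hv', hφ'⟩ := e
  have hw_ext : ExteriorEquivalent β v β'
      fun x y => w x * onUnitary (β x) (w y) * v x y * (w (x * y))⁻¹ :=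
    ⟨w, hw, hβ', fun _ _ => rfl⟩
  obtain rfl : v' = fun x y => scalar (c x y) *
      (w x * onUnitary (β x) (w y) * v x y * (w (x * y))⁻¹) :=
    funext₂ fun x y => eq_scalar_mul_iff.2 (hv' x y)
  obtain rfl : φ' = fun x y z => φ x y z * coboundary c x y z := funext₃ hφ'
  exact (hw_ext.isTwistedAction h).scalar_mul hc

theorem ExteriorEquivalent.trans_upToScalars {β'' : G → (A ≃⋆ₐ[ℂ] A)}
    {v'' : G → G → unitary 𝓜(ℂ, A)} {φ'' : G → G → G → Circle} (e : ExteriorEquivalent β v β' v')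
    (e' : ExteriorEquivalentUpToScalars β' v' φ β'' v'' φ'') :
    ExteriorEquivalentUpToScalars β v φ β'' v'' φ'' := by
  obtain ⟨w, hw, hβ, hv⟩ := e
  obtain ⟨w', c, hw', hc, hβ', hv', hφ⟩ := e'
  refine ⟨fun x => w' x * w x, c, hw'.mul hw, hc, fun x => ?_, fun x y => ?_, hφ⟩
  · rw [hβ', hβ, ad_mul, mul_assoc]
  · rw [hv', hβ, hv, onUnitary_mul_aut, onUnitary_ad, map_mul]
    congr 2
    group

end ExteriorEquivalence

/-! ### Square integrable functions with values in a stable C⋆-algebra -/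

section Extension

theorem bilinear_mem_of_dense_span {𝕜 E F H : Type*} [NontriviallyNormedField 𝕜]
    [NormedAddCommGroup E] [NormedSpace 𝕜 E] [NormedAddCommGroup F] [NormedSpace 𝕜 F]
    [NormedAddCommGroup H] [NormedSpace 𝕜 H] (B : E →L[𝕜] F →L[𝕜] H) {s : Set E} {t : Set F}
    (hs : Dense (Submodule.span 𝕜 s : Set E)) (ht : Dense (Submodule.span 𝕜 t : Set F))
    {K : Submodule 𝕜 H} (hK : IsClosed (K : Set H)) (h : ∀ x ∈ s, ∀ y ∈ t, B x y ∈ K) (x : E)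
    (y : F) : B x y ∈ K := by
  have h_left : ∀ x ∈ s, ∀ y, B x y ∈ K := fun x hx y => by
    have hle : Submodule.span 𝕜 t ≤ K.comap (B x : F →ₗ[𝕜] H) := Submodule.span_le.2 (h x hx)
    exact ht.induction hle (hK.preimage (B x).continuous) y
  have hle : Submodule.span 𝕜 s ≤ K.comap (B.flip y : E →ₗ[𝕜] H) :=
    Submodule.span_le.2 fun x hx => h_left x hx y
  exact hs.induction hle (hK.preimage (B.flip y).continuous) x

variable {A V E : Type*} [NonUnitalCStarAlgebra A] [AddCommGroup V] [Module ℂ V]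
  [NormedAddCommGroup E] [NormedSpace ℂ E]

theorem exists_extension_star_mul_eq {B : E → E → A}
    (hB : Continuous fun p : E × E => B p.1 p.2) {C : ℝ} (hC : ∀ g, ‖B g g‖ ≤ C * ‖g‖ ^ 2)
    (e : V →ₗ[ℂ] E) (he : DenseRange e) (f : V →ₗ[ℂ] A)
    (h : ∀ x y, star (f x) * f y = B (e x) (e y)) :
    ∃ U : E →L[ℂ] A, (∀ x, U (e x) = f x) ∧ ∀ g g', star (U g) * U g' = B g g' := by
  have hbound : ∃ D, ∀ x, ‖f x‖ ≤ D * ‖e x‖ := by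
    refine ⟨√(max C 0), fun x => ?_⟩
    rw [← Real.sqrt_sq (norm_nonneg (e x)), ← Real.sqrt_mul (le_max_right _ _)]
    refine Real.le_sqrt_of_sq_le ?_
    calc ‖f x‖ ^ 2 = ‖B (e x) (e x)‖ := by rw [← h, CStarRing.norm_star_mul_self, sq]
      _ ≤ C * ‖e x‖ ^ 2 := hC _
      _ ≤ max C 0 * ‖e x‖ ^ 2 := by gcongr; exact le_max_left _ _
  let U : E →L[ℂ] A := f.extendOfNorm e
  have hU : ∀ x, U (e x) = f x := LinearMap.extendOfNorm_eq he hbound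
  refine ⟨U, hU, fun g g' => ?_⟩
  refine he.induction_on₂ (p := fun g g' => star (U g) * U g' = B g g') ?_ (fun x y => ?_) g g'
  · exact isClosed_eq (by fun_prop) hB
  · rw [hU, hU, h]

theorem star_lsum_mul_lsum [NormedSpace ℝ E] {ι : Type*} (B : E →L[ℝ] E →L[ℝ] A)
    (e : ι → V →ₗ[ℂ] E) (f : ι → V →ₗ[ℂ] A)
    (h : ∀ p q a b, star (f p a) * f q b = B (e p a) (e q b)) (x y : ι →₀ V) :
    star (Finsupp.lsum ℂ f x) * Finsupp.lsum ℂ f y =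
      B (Finsupp.lsum ℂ e x) (Finsupp.lsum ℂ e y) := by
  induction x using Finsupp.induction_linear with
  | zero => simp
  | add x x' hx hx' =>
    rw [map_add, map_add, star_add, add_mul, hx, hx', map_add, add_apply]
  | single p a =>
    induction y using Finsupp.induction_linear with
    | zero => simp
    | add y y' hy hy' => rw [map_add, map_add, mul_add, hy, hy', map_add]
    | single q b => simpa only [Finsupp.lsum_single] using h p q a b

end Extension

section HilbertBasis

variable {𝕜 E : Type*} [RCLike 𝕜] [NormedAddCommGroup E] [InnerProductSpace 𝕜 E]
  [TopologicalSpace.SeparableSpace E]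

theorem countable_of_orthonormal {ι : Type*} {b : ι → E} (hb : Orthonormal 𝕜 b) : Countable ι := by
  refine Pairwise.countable_of_isOpen_disjoint (s := fun i => Metric.ball (b i) (1 / 2))
    (fun i j hij => Metric.ball_disjoint_ball ?_) (fun i => Metric.isOpen_ball)
    (fun i => ⟨b i, Metric.mem_ball_self (by norm_num)⟩)
  have hdist : ‖b i - b j‖ ^ 2 = 2 := by
    rw [@norm_sub_sq 𝕜, hb.1, hb.1, hb.2 hij]
    norm_num
  rw [dist_eq_norm]
  nlinarith [norm_nonneg (b i - b j)]

variable (𝕜 E) in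
theorem exists_countable_hilbertBasis [CompleteSpace E] [Nontrivial E] :
    ∃ (κ : Set E) (_ : HilbertBasis κ 𝕜 E), Countable κ ∧ Nonempty κ := by
  obtain ⟨κ, b, -⟩ := exists_hilbertBasis 𝕜 E
  refine ⟨κ, b, countable_of_orthonormal b.orthonormal, ?_⟩
  by_contra hκ
  have hspan := b.dense_span
  rw [not_nonempty_iff] at hκ
  rw [Set.range_eq_empty, Submodule.span_empty,
    IsClosed.submodule_topologicalClosure_eq isClosed_singleton] at hspan
  exact bot_ne_top hspan

end HilbertBasis

section Tensor

open scoped ENNReal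

variable {T E : Type*} [MeasurableSpace T] [NormedAddCommGroup E] [NormedSpace ℂ E]
  {μ : Measure T} {p : ℝ≥0∞} [Fact (1 ≤ p)]

variable (E p μ) in
/-- The function `t ↦ f(t) a` in `Lᵖ(T; E)`, for `f` in `Lᵖ(T)` and `a` in `E`, as a bilinear
map. -/
def tensorLp : Lp ℂ p μ →L[ℂ] E →L[ℂ] Lp E p μ :=
  LinearMap.mkContinuous₂
    (LinearMap.mk₂ ℂ (fun f a => (ContinuousLinearMap.toSpanSingleton ℂ a).compLpL p μ f)
      (fun f g a => map_add _ f g) (fun c f a => map_smul _ c f)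
      (fun f a b => by
        rw [ContinuousLinearMap.toSpanSingleton_add, ContinuousLinearMap.add_compLpL]; rfl)
      (fun c f a => by
        rw [ContinuousLinearMap.toSpanSingleton_smul, ContinuousLinearMap.smul_compLpL]; rfl))
    1 (fun f a => by
      refine (ContinuousLinearMap.norm_compLp_le _ _).trans ?_
      rw [ContinuousLinearMap.norm_toSpanSingleton, one_mul, mul_comm])

theorem tensorLp_coeFn (f : Lp ℂ p μ) (a : E) : tensorLp E μ p f a =ᵐ[μ] fun t => f t • a :=
  (ContinuousLinearMap.toSpanSingleton ℂ a).coeFn_compLp f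

theorem tensorLp_indicatorConstLp {s : Set T} (hs : MeasurableSet s) (hμs : μ s ≠ ∞) (a : E) :
    tensorLp E μ p (indicatorConstLp p hs hμs 1) a = indicatorConstLp p hs hμs a := by
  refine Lp.ext ?_
  filter_upwards [tensorLp_coeFn (indicatorConstLp p hs hμs (1 : ℂ)) a,
    indicatorConstLp_coeFn (p := p) (hs := hs) (hμs := hμs) (c := a),
    indicatorConstLp_coeFn (p := p) (hs := hs) (hμs := hμs) (c := (1 : ℂ))] with t h1 h2 h3
  rw [h1, h2, h3]
  by_cases ht : t ∈ s <;> simp [ht]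

theorem eq_top_of_forall_tensorLp_mem (hp : p ≠ ∞) {K : Submodule ℂ (Lp E p μ)}
    (hK : IsClosed (K : Set (Lp E p μ))) (h : ∀ f a, tensorLp E μ p f a ∈ K) : K = ⊤ := by
  refine eq_top_iff.2 fun g _ => ?_
  refine Lp.induction hp (fun g => g ∈ K) ?_ (fun f g hf hg _ => K.add_mem) hK g
  intro a s hs hμs
  rw [Lp.simpleFunc.coe_indicatorConst, ← tensorLp_indicatorConstLp]
  exact h _ _

end Tensor

section L2

open scoped ENNReal

variable {T A : Type*} [MeasurableSpace T] {μ : Measure T} [NonUnitalCStarAlgebra A]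

variable (A μ) in
/-- The `A`-valued inner product `∫ g(t)⋆ h(t) dt` on `L²(T; A)`. It is conjugate linear in `g`,
hence bundled as a real bilinear map. -/
def innerL2 : Lp A 2 μ →L[ℝ] Lp A 2 μ →L[ℝ] A :=
  ((ContinuousLinearMap.mul ℝ A).comp
    ((starL' ℝ : A ≃L[ℝ] A) : A →L[ℝ] A)).lpPairing μ 2 2

theorem innerL2_apply (g h : Lp A 2 μ) : innerL2 A μ g h = ∫ t, star (g t) * h t ∂μ :=
  ContinuousLinearMap.lpPairing_eq_integral _ _ _

theorem innerL2_tensorLp (f g : Lp ℂ 2 μ) (a b : A) :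
    innerL2 A μ (tensorLp A μ 2 f a) (tensorLp A μ 2 g b) = inner ℂ f g • (star a * b) := by
  rw [innerL2_apply, L2.inner_def, ← integral_smul_const]
  refine integral_congr_ae ?_
  filter_upwards [tensorLp_coeFn f a, tensorLp_coeFn g b] with t hf hg
  rw [hf, hg, star_smul, smul_mul_smul_comm, RCLike.inner_apply', RCLike.star_def]

theorem norm_innerL2_self_le (g : Lp A 2 μ) : ‖innerL2 A μ g g‖ ≤ ‖innerL2 A μ‖ * ‖g‖ ^ 2 := by
  rw [sq, ← mul_assoc]
  exact (innerL2 A μ).le_opNorm₂ g g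

theorem denseRange_lsum_tensorLp {κ ι : Type*} {b : κ → Lp ℂ 2 μ}
    (hb : Dense (Submodule.span ℂ (Set.range b) : Set (Lp ℂ 2 μ))) {e : ι → A →ₗ[ℂ] A}
    (he : Dense ((⨆ i, LinearMap.range (e i) : Submodule ℂ A) : Set A)) :
    DenseRange (Finsupp.lsum ℂ fun p : κ × ι =>
      (tensorLp A μ 2 (b p.1) : A →ₗ[ℂ] Lp A 2 μ) ∘ₗ e p.2) := by
  set R := LinearMap.range (Finsupp.lsum ℂ fun p : κ × ι =>
    (tensorLp A μ 2 (b p.1) : A →ₗ[ℂ] Lp A 2 μ) ∘ₗ e p.2)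
  have he_span : Dense (Submodule.span ℂ (⋃ i, (LinearMap.range (e i) : Set A)) : Set A) := by
    simpa only [Submodule.span_iUnion, Submodule.span_eq] using he
  have htop : R.topologicalClosure = ⊤ := by
    refine eq_top_of_forall_tensorLp_mem (by norm_num) R.isClosed_topologicalClosure
      (bilinear_mem_of_dense_span (tensorLp A μ 2) hb he_span R.isClosed_topologicalClosure ?_)
    rintro _ ⟨k, rfl⟩ a ha
    obtain ⟨i, a, rfl⟩ := Set.mem_iUnion.1 ha
    exact R.le_topologicalClosure ⟨Finsupp.single (k, i) a, by simp⟩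
  exact Submodule.dense_iff_topologicalClosure_eq_top.2 htop

/-- An isomorphism of Hilbert `A`-modules `L²(T; A) ≅ A` for stable `A`. The norm of `Lp A 2 μ` is
larger than the Hilbert module norm, so `U` is only claimed to have dense range. -/
theorem IsStable.exists_unitary_L2 (hA : IsStable A) [MeasurableSpace.CountablyGenerated T]
    [SigmaFinite μ] [Nontrivial (Lp ℂ 2 μ)] :
    ∃ U : Lp A 2 μ →L[ℂ] A, DenseRange U ∧ ∀ g h, star (U g) * U h = innerL2 A μ g h := by
  classical
  obtain ⟨e, he_mul, he_star, -, he_dense⟩ := hA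
  have : Fact ((2 : ℝ≥0∞) ≠ ∞) := ⟨by norm_num⟩
  obtain ⟨κ, b, _, _⟩ := exists_countable_hilbertBasis ℂ (Lp ℂ 2 μ)
  obtain ⟨σ⟩ : Nonempty (κ × ℕ ≃ ℕ) := nonempty_equiv_of_countable
  -- `U` maps `b_k ⊗ (a ⊗ e_{ij})` to `a ⊗ e_{σ(k,i)j}`.
  let f : κ × ℕ × ℕ → A →ₗ[ℂ] A := fun p => e (σ (p.1, p.2.1)) p.2.2
  let E : κ × ℕ × ℕ → A →ₗ[ℂ] Lp A 2 μ :=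
    fun p => (tensorLp A μ 2 (b p.1) : A →ₗ[ℂ] Lp A 2 μ) ∘ₗ e p.2.1 p.2.2
  have hEf : ∀ p q a c, star (f p a) * f q c = innerL2 A μ (E p a) (E q c) := by
    rintro ⟨k, i, j⟩ ⟨l, m, n⟩ a c
    change star (e (σ (k, i)) j a) * e (σ (l, m)) n c =
      innerL2 A μ (tensorLp A μ 2 (b k) (e i j a)) (tensorLp A μ 2 (b l) (e m n c))
    rw [innerL2_tensorLp, he_star, he_star, he_mul, he_mul,
      orthonormal_iff_ite.1 b.orthonormal]
    by_cases hkl : k = l <;> by_cases him : i = m <;> simp [hkl, him]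
  have he_dense' : Dense ((⨆ p : ℕ × ℕ, LinearMap.range (e p.1 p.2) : Submodule ℂ A) : Set A) := by
    simpa only [iSup_prod] using he_dense
  have hE_dense : DenseRange (Finsupp.lsum ℂ E) := denseRange_lsum_tensorLp
    (e := fun p : ℕ × ℕ => e p.1 p.2)
    (Submodule.dense_iff_topologicalClosure_eq_top.2 b.dense_span) he_dense'
  obtain ⟨U, hU, hU_inner⟩ := exists_extension_star_mul_eq (B := fun g h => innerL2 A μ g h)
    (by fun_prop) norm_innerL2_self_le _ hE_dense (Finsupp.lsum ℂ f)
    (star_lsum_mul_lsum (innerL2 A μ) E f hEf)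
  refine ⟨U, he_dense'.mono ?_, hU_inner⟩
  have hle : (⨆ p : ℕ × ℕ, LinearMap.range (e p.1 p.2)) ≤
      LinearMap.range (U : Lp A 2 μ →ₗ[ℂ] A) := by
    refine iSup_le fun ⟨i, j⟩ => ?_
    rintro _ ⟨a, rfl⟩
    refine ⟨Finsupp.lsum ℂ E (Finsupp.single ((σ.symm i).1, (σ.symm i).2, j) a), ?_⟩
    rw [ContinuousLinearMap.coe_coe, hU, Finsupp.lsum_single]
    simp only [f, Prod.mk.eta, Equiv.apply_symm_apply]
  exact hle

end L2

section L2Measurable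

variable {X T E : Type*} [MeasurableSpace X] [MeasurableSpace T] {μ : Measure T} [SigmaFinite μ]
  [MeasurableSpace.CountablyGenerated T] [NormedAddCommGroup E] [NormedSpace ℂ E]

theorem stronglyMeasurable_toLp_complex {f : X × T → ℂ} (hf : StronglyMeasurable f)
    (h : ∀ x, MemLp (fun t => f (x, t)) 2 μ) : StronglyMeasurable fun x => (h x).toLp := by
  have : Fact ((2 : ENNReal) ≠ ⊤) := ⟨by norm_num⟩
  obtain ⟨κ, b, -⟩ := exists_hilbertBasis ℂ (Lp ℂ 2 μ)
  have : Countable κ := countable_of_orthonormal b.orthonormal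
  have hcoeff (k : κ) : StronglyMeasurable fun x => b.repr (h x).toLp k := by
    have hrepr : (fun x => b.repr (h x).toLp k) = fun x => ∫ t, star (b k t) * f (x, t) ∂μ := by
      funext x
      rw [b.repr_apply_apply, L2.inner_def]
      refine integral_congr_ae ?_
      filter_upwards [(h x).coeFn_toLp] with t ht
      rw [ht, RCLike.inner_apply', RCLike.star_def]
    rw [hrepr]
    exact (((Lp.stronglyMeasurable (b k)).comp_measurable measurable_snd).star.mul
      hf).integral_prod_right'
  exact stronglyMeasurable_of_tendsto (Filter.atTop : Filter (Finset κ))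
    (fun s => Finset.stronglyMeasurable_fun_sum s fun k _ => (hcoeff k).smul_const (b k))
    (tendsto_pi_nhds.2 fun x => b.hasSum_repr _)

theorem stronglyMeasurable_toLp_smul_const {f : X × T → ℂ} (hf : StronglyMeasurable f) (a : E)
    (h : ∀ x, MemLp (fun t => f (x, t) • a) 2 μ) : StronglyMeasurable fun x => (h x).toLp := by
  rcases eq_or_ne a 0 with rfl | ha
  · have hzero : (fun x => (h x).toLp) = fun _ => 0 := by
      funext x
      exact (MemLp.toLp_eq_toLp_iff (h x) MemLp.zero).2 (.of_forall fun t => smul_zero _)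
    rw [hzero]
    exact stronglyMeasurable_const
  have hf_memLp (x : X) : MemLp (fun t => f (x, t)) 2 μ := by
    refine (h x).of_le_mul (c := ‖a‖⁻¹)
      (hf.comp_measurable measurable_prodMk_left).aestronglyMeasurable (.of_forall fun t => ?_)
    rw [norm_smul, mul_comm, mul_inv_cancel_right₀ (norm_ne_zero_iff.2 ha)]
  have htensor : (fun x => (h x).toLp) = fun x => tensorLp E μ 2 (hf_memLp x).toLp a := by
    funext x
    refine Lp.ext ?_
    filter_upwards [(h x).coeFn_toLp, (hf_memLp x).coeFn_toLp,
      tensorLp_coeFn (hf_memLp x).toLp a] with t h1 h2 h3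
    rw [h1, h3, h2]
  rw [htensor]
  exact ((tensorLp E μ 2).flip a).continuous.comp_stronglyMeasurable
    (stronglyMeasurable_toLp_complex hf hf_memLp)

theorem stronglyMeasurable_toLp_simpleFunc (f : SimpleFunc (X × T) E)
    (h : ∀ x, MemLp (fun t => f (x, t)) 2 μ) : StronglyMeasurable fun x => (h x).toLp := by
  induction f using SimpleFunc.induction with
  | @const a s hs =>
    have hsmul (p : X × T) :
        SimpleFunc.piecewise s hs (.const _ a) (.const _ 0) p =
          s.indicator (fun _ => (1 : ℂ)) p • a := by
      classical
      by_cases hp : p ∈ s <;> simp [hp]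
    simp only [hsmul] at h ⊢
    exact stronglyMeasurable_toLp_smul_const (stronglyMeasurable_const.indicator hs) a h
  | @add f g hfg hf hg =>
    have hle (p : X × T) : ‖f p‖ ≤ ‖(f + g) p‖ ∧ ‖g p‖ ≤ ‖(f + g) p‖ := by
      by_cases hp : p ∈ Function.support f
      · have hgp : g p = 0 := by simpa using Set.disjoint_left.1 hfg hp
        simp [hgp]
      · have hfp : f p = 0 := by simpa using hp
        simp [hfp]
    have hf_memLp (x : X) : MemLp (fun t => f (x, t)) 2 μ := (h x).of_le
      (f.stronglyMeasurable.comp_measurable measurable_prodMk_left).aestronglyMeasurable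
      (.of_forall fun t => (hle _).1)
    have hg_memLp (x : X) : MemLp (fun t => g (x, t)) 2 μ := (h x).of_le
      (g.stronglyMeasurable.comp_measurable measurable_prodMk_left).aestronglyMeasurable
      (.of_forall fun t => (hle _).2)
    exact (hf hf_memLp).add (hg hg_memLp)

theorem stronglyMeasurable_toLp {f : X × T → E} (hf : StronglyMeasurable f)
    (h : ∀ x, MemLp (fun t => f (x, t)) 2 μ) : StronglyMeasurable fun x => (h x).toLp := by
  borelize E
  set s : Set E := Set.range f ∪ {0}
  have : TopologicalSpace.SeparableSpace s := hf.separableSpace_range_union_singleton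
  have hs : (0 : E) ∈ s := Or.inr rfl
  have hf_section (x : X) : Measurable fun t => f (x, t) :=
    hf.measurable.comp measurable_prodMk_left
  let F : ℕ → SimpleFunc (X × T) E := SimpleFunc.approxOn f hf.measurable s 0 hs
  have hF (n : ℕ) (x : X) : MemLp (fun t => F n (x, t)) 2 μ :=
    SimpleFunc.memLp_approxOn (hf_section x) (h x) hs MemLp.zero n
  refine stronglyMeasurable_of_tendsto Filter.atTop
    (fun n => stronglyMeasurable_toLp_simpleFunc (F n) (hF n)) (tendsto_pi_nhds.2 fun x => ?_)
  refine (Lp.tendsto_Lp_iff_tendsto_eLpNorm'' _ (fun n => hF n x) _ (h x)).2 ?_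
  refine SimpleFunc.tendsto_approxOn_Lp_eLpNorm (hf_section x) hs (by norm_num)
    (.of_forall fun t => subset_closure (Or.inl ⟨_, rfl⟩)) ?_
  simpa only [sub_zero] using (h x).eLpNorm_lt_top

end L2Measurable

theorem nontrivial_Lp_of_sigmaFinite {T E : Type*} [MeasurableSpace T] (μ : Measure T)
    [SigmaFinite μ] [NeZero μ] [NormedAddCommGroup E] [Nontrivial E] {p : ENNReal} (hp : p ≠ 0)
    (hp_top : p ≠ ⊤) : Nontrivial (Lp E p μ) := by
  obtain ⟨a, ha⟩ := exists_ne (0 : E)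
  obtain ⟨s, hs, -, hs_pos, hs_lt_top⟩ := μ.exists_subset_measure_lt_top MeasurableSet.univ
    (Measure.measure_univ_pos.2 (NeZero.ne μ))
  refine ⟨indicatorConstLp p hs hs_lt_top.ne a, 0, fun h => ?_⟩
  have hnorm := congrArg norm h
  rw [norm_indicatorConstLp hp hp_top, Lp.norm_zero] at hnorm
  have hpos : 0 < μ.real s := ENNReal.toReal_pos hs_pos.ne' hs_lt_top.ne
  exact (mul_pos (norm_pos_iff.2 ha) (Real.rpow_pos_of_pos hpos _)).ne' hnorm

section Isometries

variable {A : Type*} [NonUnitalCStarAlgebra A]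

theorem exists_unitary_fst_eq {T : A →L[ℂ] A} (hT : ∀ a b, star (T a) * T b = star a * b)
    (hsurj : Function.Surjective T) :
    ∃ u : unitary 𝓜(ℂ, A), ∀ a, (u : 𝓜(ℂ, A)).fst a = T a := by
  have hnorm (a : A) : ‖T a‖ = ‖a‖ := norm_eq_norm_of_star_mul_self_eq (hT a a)
  let e : A ≃ₗᵢ[ℂ] A := LinearIsometryEquiv.ofSurjective ⟨T, hnorm⟩ hsurj
  have hTe : ∀ a, T (e.symm a) = a := e.apply_symm_apply
  have heT : ∀ a, e.symm (T a) = a := e.symm_apply_apply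
  let S : A →L[ℂ] A :=
    { toFun := fun a => star (e.symm (star a))
      map_add' := fun a b => by simp
      map_smul' := fun c a => by simp
      cont := by fun_prop }
  let m : 𝓜(ℂ, A) :=
    { fst := T
      snd := S
      central := fun a b => by
        change star (e.symm (star a)) * b = a * T b
        rw [← hT, hTe, star_star] }
  refine ⟨⟨m, Unitary.mem_iff.2 ⟨multiplier_ext fun a => ?_, multiplier_ext fun a => ?_⟩⟩,
    fun a => rfl⟩
  · change star (star (e.symm (star (star (T a))))) = a
    rw [star_star, star_star, heT]
  · change T (star (star (e.symm (star (star a))))) = a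
    rw [star_star, star_star, hTe]

theorem integral_aut {T : Type*} [MeasurableSpace T] (μ : Measure T) (β : A ≃⋆ₐ[ℂ] A)
    (f : T → A) : ∫ t, β (f t) ∂μ = β (∫ t, f t ∂μ) :=
  (ContinuousLinearEquiv.equivOfInverse (autCLM β) (autCLM β.symm) β.symm_apply_apply
    β.apply_symm_apply).integral_comp_comm f

theorem integral_snd {T : Type*} [MeasurableSpace T] (μ : Measure T) (u : unitary 𝓜(ℂ, A))
    (f : T → A) : ∫ t, (u : 𝓜(ℂ, A)).snd (f t) ∂μ = (u : 𝓜(ℂ, A)).snd (∫ t, f t ∂μ) :=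
  (ContinuousLinearEquiv.equivOfInverse (u : 𝓜(ℂ, A)).snd (star (u : 𝓜(ℂ, A))).snd
    (snd_mul_star_cancel u) (snd_star_mul_cancel u)).integral_comp_comm f

end Isometries

section WeightedComposition

variable {T A E F : Type*} [MeasurableSpace T] {μ : Measure T}
  [NormedAddCommGroup E] [NormedSpace ℂ E] [NormedAddCommGroup F] [NormedSpace ℂ F]
  {L : T → E →L[ℂ] F} {τ : T → T} {p : ENNReal}

theorem memLp_weightedComp (hL : ∀ a, StronglyMeasurable fun t => L t a)
    (hL_norm : ∀ t a, ‖L t a‖ ≤ ‖a‖) (hτ : MeasurePreserving τ μ μ) (g : Lp E p μ) :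
    MemLp (fun t => L t (g (τ t))) p μ :=
  ((Lp.memLp g).comp_measurePreserving hτ).of_le
    (stronglyMeasurable_apply (fun t => (L t).continuous) hL
      ((Lp.stronglyMeasurable g).comp_measurable hτ.measurable)).aestronglyMeasurable
    (.of_forall fun _ => hL_norm _ _)

/-- The operator `g ↦ (t ↦ L_t g(τ(t)))` from `Lᵖ(T; E)` to `Lᵖ(T; F)`, for contractions `L_t` and
a measure preserving map `τ`. -/
def weightedComp (hL : ∀ a, StronglyMeasurable fun t => L t a)
    (hL_norm : ∀ t a, ‖L t a‖ ≤ ‖a‖) (hτ : MeasurePreserving τ μ μ) :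
    Lp E p μ →ₗ[ℂ] Lp F p μ where
  toFun g := (memLp_weightedComp hL hL_norm hτ g).toLp
  map_add' g h := by
    rw [← MemLp.toLp_add]
    refine (MemLp.toLp_eq_toLp_iff _ _).2 ?_
    filter_upwards [hτ.quasiMeasurePreserving.ae_eq_comp (Lp.coeFn_add g h)] with t ht
    simp only [Function.comp_apply, Pi.add_apply] at ht ⊢
    rw [ht, map_add]
  map_smul' c g := by
    rw [RingHom.id_apply, ← MemLp.toLp_const_smul]
    refine (MemLp.toLp_eq_toLp_iff _ _).2 ?_
    filter_upwards [hτ.quasiMeasurePreserving.ae_eq_comp (Lp.coeFn_smul c g)] with t ht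
    simp only [Function.comp_apply, Pi.smul_apply] at ht ⊢
    rw [ht, map_smul]

theorem weightedComp_coeFn (hL : ∀ a, StronglyMeasurable fun t => L t a)
    (hL_norm : ∀ t a, ‖L t a‖ ≤ ‖a‖) (hτ : MeasurePreserving τ μ μ) (g : Lp E p μ) :
    weightedComp hL hL_norm hτ g =ᵐ[μ] fun t => L t (g (τ t)) :=
  (memLp_weightedComp hL hL_norm hτ g).coeFn_toLp

end WeightedComposition

/-! ### Untwisting on a stable C⋆-algebra -/

namespace IsTwistedAction

variable {G A : Type*} [CommGroup G] [MeasurableSpace G] [NonUnitalCStarAlgebra A]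
  {β : G → (A ≃⋆ₐ[ℂ] A)} {v : G → G → unitary 𝓜(ℂ, A)} {φ : G → G → G → Circle}

theorem action_action (h : IsTwistedAction β v φ) (x y : G) (a : A) :
    β x (β y a) = (((v x y)⁻¹ : unitary 𝓜(ℂ, A)) : 𝓜(ℂ, A)).snd
      ((v x y : 𝓜(ℂ, A)).fst (β (x * y) a)) := by
  have hcomp : β x (β y a) = ad (v x y) (β (x * y) a) := DFunLike.congr_fun (h.comp x y) a
  rw [hcomp, ad_apply, fst_snd, coe_inv_eq_star]

theorem fst_inv_action_fst_inv_action (h : IsTwistedAction β v 1) (x y z : G) (a : A) :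
    (((v x (y * z))⁻¹ : unitary 𝓜(ℂ, A)) : 𝓜(ℂ, A)).fst
        (β x ((((v y z)⁻¹ : unitary 𝓜(ℂ, A)) : 𝓜(ℂ, A)).fst (β y a))) =
      (((v x y)⁻¹ : unitary 𝓜(ℂ, A)) : 𝓜(ℂ, A)).snd
        ((((v (x * y) z)⁻¹ : unitary 𝓜(ℂ, A)) : 𝓜(ℂ, A)).fst (β (x * y) a)) := by
  have hcocycle : v x y * v (x * y) z = onUnitary (β x) (v y z) * v x (y * z) := by
    simpa only [Pi.one_apply, map_one, one_mul] using h.cocycle_eq x y z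
  have hinv : (v x (y * z))⁻¹ * (onUnitary (β x) (v y z))⁻¹ * v x y = (v (x * y) z)⁻¹ := by
    rw [← mul_inv_rev, ← hcocycle, mul_inv_rev, inv_mul_cancel_right]
  rw [map_fst, h.action_action, map_inv, ← coe_mul_fst, fst_snd, ← coe_mul_fst, hinv]

section RegularRepresentation

variable [MeasurableMul₂ G]

/-- The operators `(W_x g)(t) = v(x, x⁻¹t)⁻¹ β_x(g(x⁻¹t))` on `L²(G; A)`, which form the regular
representation of a twisted action. -/
def regularOp (h : IsTwistedAction β v φ) (μ : Measure G) [μ.IsMulLeftInvariant] (x : G) :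
    Lp A 2 μ →ₗ[ℂ] Lp A 2 μ :=
  weightedComp
    (L := fun t => (((v x (x⁻¹ * t))⁻¹ : unitary 𝓜(ℂ, A)) : 𝓜(ℂ, A)).fst.comp (autCLM (β x)))
    (fun _ => ((h.measurable_twist.comp (g := fun t => (x, x⁻¹ * t)) (by fun_prop)).inv _).1)
    (fun t a => ((norm_fst_apply (v x (x⁻¹ * t))⁻¹ _).trans
      (NonUnitalStarAlgHom.norm_map (β x) (β x).injective a)).le)
    (measurePreserving_mul_left μ x⁻¹)

variable {μ : Measure G} [μ.IsMulLeftInvariant]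

theorem regularOp_coeFn (h : IsTwistedAction β v φ) (x : G) (g : Lp A 2 μ) :
    h.regularOp μ x g =ᵐ[μ] fun t =>
      (((v x (x⁻¹ * t))⁻¹ : unitary 𝓜(ℂ, A)) : 𝓜(ℂ, A)).fst (β x (g (x⁻¹ * t))) :=
  weightedComp_coeFn _ _ _ g

theorem innerL2_regularOp_regularOp (h : IsTwistedAction β v φ) (x : G) (f g : Lp A 2 μ) :
    innerL2 A μ (h.regularOp μ x f) (h.regularOp μ x g) = β x (innerL2 A μ f g) := by
  rw [innerL2_apply, innerL2_apply, ← integral_aut,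
    ← integral_mul_left_eq_self (fun t => β x (star (f t) * g t)) x⁻¹]
  refine integral_congr_ae ?_
  filter_upwards [h.regularOp_coeFn x f, h.regularOp_coeFn x g] with t hf hg
  rw [hf, hg, star_fst_mul_fst, map_mul, map_star]

theorem regularOp_regularOp_coeFn (h : IsTwistedAction β v 1) (x y : G) (g : Lp A 2 μ) :
    h.regularOp μ x (h.regularOp μ y g) =ᵐ[μ] fun t =>
      (((v x y)⁻¹ : unitary 𝓜(ℂ, A)) : 𝓜(ℂ, A)).snd (h.regularOp μ (x * y) g t) := by
  filter_upwards [h.regularOp_coeFn x (h.regularOp μ y g), h.regularOp_coeFn (x * y) g,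
    (measurePreserving_mul_left μ x⁻¹).quasiMeasurePreserving.ae_eq_comp (h.regularOp_coeFn y g)]
    with t hx hxy hy
  have hy_mul : x⁻¹ * t = y * ((x * y)⁻¹ * t) := by group
  have hxy_inv : y⁻¹ * (x⁻¹ * t) = (x * y)⁻¹ * t := by group
  simp only [Function.comp_apply] at hy
  rw [hx, hy, hxy, hxy_inv, hy_mul]
  exact h.fst_inv_action_fst_inv_action x y _ _

theorem innerL2_regularOp_comp (h : IsTwistedAction β v 1) (x y : G) (f g : Lp A 2 μ) :
    innerL2 A μ f (h.regularOp μ x (h.regularOp μ y g)) =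
      (((v x y)⁻¹ : unitary 𝓜(ℂ, A)) : 𝓜(ℂ, A)).snd
        (innerL2 A μ f (h.regularOp μ (x * y) g)) := by
  rw [innerL2_apply, innerL2_apply, ← integral_snd]
  refine integral_congr_ae ?_
  filter_upwards [h.regularOp_regularOp_coeFn x y g] with t ht
  rw [ht, snd_mul]

theorem stronglyMeasurable_regularOp [MeasurableInv G] [MeasurableSpace.CountablyGenerated G]
    [SigmaFinite μ] (h : IsTwistedAction β v φ) (g : Lp A 2 μ) :
    StronglyMeasurable fun x => h.regularOp μ x g := by
  have hv : StrictlyMeasurable fun p : G × G => (v p.1 (p.1⁻¹ * p.2))⁻¹ :=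
    (h.measurable_twist.comp (g := fun p : G × G => (p.1, p.1⁻¹ * p.2)) (by fun_prop)).inv
  have hg : StronglyMeasurable fun p : G × G => g (p.1⁻¹ * p.2) :=
    (Lp.stronglyMeasurable g).comp_measurable (by fun_prop)
  exact stronglyMeasurable_toLp (hv.fst_apply (stronglyMeasurable_aut_apply
    (fun a => (h.measurable_action a).comp_measurable measurable_fst) hg))
    fun x => (Lp.memLp (h.regularOp μ x g)).ae_eq (h.regularOp_coeFn x g)

end RegularRepresentation

end IsTwistedAction

section TwistedRepresentation

variable {G A : Type*} [CommGroup G] [MeasurableSpace G] [NonUnitalCStarAlgebra A]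
  {β : G → (A ≃⋆ₐ[ℂ] A)} {v : G → G → unitary 𝓜(ℂ, A)} {Y : G → A →L[ℂ] A}

/-- A representation `Y` of a twisted action `(β, v)` on `A` as a Hilbert module over itself: each
`Y_x` is a `β_x`-isometry, and `Y_x Y_y` is `Y_{xy}` followed by right multiplication by
`v(x, y)⁻¹`. -/
structure IsTwistedRepresentation (β : G → (A ≃⋆ₐ[ℂ] A)) (v : G → G → unitary 𝓜(ℂ, A))
    (Y : G → A →L[ℂ] A) : Prop where
  measurable : ∀ a, StronglyMeasurable fun x => Y x a
  star_mul : ∀ x a b, star (Y x a) * Y x b = β x (star a * b)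
  comp : ∀ x y a, Y x (Y y a) = (((v x y)⁻¹ : unitary 𝓜(ℂ, A)) : 𝓜(ℂ, A)).snd (Y (x * y) a)

theorem IsStable.exists_isTwistedRepresentation (hA : IsStable A) (h : IsTwistedAction β v 1)
    [MeasurableMul₂ G] [MeasurableInv G] [MeasurableSpace.CountablyGenerated G]
    (μ : Measure G) [SigmaFinite μ] [NeZero μ] [μ.IsMulLeftInvariant] :
    ∃ Y : G → A →L[ℂ] A, IsTwistedRepresentation β v Y := by
  have : Nontrivial (Lp ℂ 2 μ) := nontrivial_Lp_of_sigmaFinite μ (by norm_num) (by norm_num)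
  obtain ⟨U, hU_dense, hU⟩ := hA.exists_unitary_L2 (μ := μ)
  have hβ (x : G) : Continuous (β x) := (autCLM (β x)).continuous
  have hextend (x : G) : ∃ Y : A →L[ℂ] A, (∀ g, Y (U g) = U (h.regularOp μ x g)) ∧
      ∀ a b, star (Y a) * Y b = β x (star a * b) := by
    refine exists_extension_star_mul_eq (C := 1) (by fun_prop) (fun a => ?_)
      (U : Lp A 2 μ →ₗ[ℂ] A) hU_dense ((U : Lp A 2 μ →ₗ[ℂ] A) ∘ₗ h.regularOp μ x)
      fun f g => ?_
    · rw [NonUnitalStarAlgHom.norm_map (β x) (β x).injective, CStarRing.norm_star_mul_self, one_mul,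
        sq]
    · change star (U (h.regularOp μ x f)) * U (h.regularOp μ x g) = β x (star (U f) * U g)
      rw [hU, hU, h.innerL2_regularOp_regularOp]
  choose Y hYU hY_star_mul using hextend
  refine ⟨Y, fun a => ?_, hY_star_mul, fun x y a => ?_⟩
  · obtain ⟨b, hb, hba⟩ := mem_closure_iff_seq_limit.1 (hU_dense a)
    choose g hg using hb
    refine stronglyMeasurable_of_tendsto Filter.atTop (f := fun n x => Y x (b n)) (fun n => ?_)
      (tendsto_pi_nhds.2 fun x => ((Y x).continuous.tendsto a).comp hba)
    simp only [← hg, hYU]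
    exact U.continuous.comp_stronglyMeasurable (h.stronglyMeasurable_regularOp (g n))
  · set V := ((v x y)⁻¹ : unitary 𝓜(ℂ, A)).1
    refine hU_dense.induction_on (p := fun a => Y x (Y y a) = V.snd (Y (x * y) a)) a
      (isClosed_eq (by fun_prop) (by fun_prop)) fun g => ?_
    refine eq_of_forall_mul_left fun z => ?_
    rw [hYU, hYU, hYU, ← star_star z]
    generalize star z = b
    refine hU_dense.induction_on b (isClosed_eq (by fun_prop) (by fun_prop)) fun f => ?_
    rw [← snd_mul, hU, hU, h.innerL2_regularOp_comp]

theorem map_snd_of_star_mul {T : A → A} {γ : A ≃⋆ₐ[ℂ] A}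
    (hT : ∀ a b, star (T a) * T b = γ (star a * b)) (u : unitary 𝓜(ℂ, A)) (a : A) :
    T ((u : 𝓜(ℂ, A)).snd a) = (onUnitary γ u : 𝓜(ℂ, A)).snd (T a) := by
  set p := T ((u : 𝓜(ℂ, A)).snd a)
  set q := (onUnitary γ u : 𝓜(ℂ, A)).snd (T a)
  have horth (c : A) : star (T c) * (p - q) = 0 := by
    rw [mul_sub, hT, ← snd_mul, map_snd, ← hT, snd_mul, sub_self]
  have horth_q : star q * (p - q) = 0 := by
    have hq : star q = (star (onUnitary γ u : 𝓜(ℂ, A))).fst (star (T a)) := by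
      rw [DoubleCentralizer.star_fst, star_star]
    rw [hq, ← fst_mul, horth, map_zero]
  have hsub : star (p - q) * (p - q) = 0 := by rw [star_sub, sub_mul, horth, horth_q, sub_zero]
  exact sub_eq_zero.1 ((CStarRing.star_mul_self_eq_zero_iff _).1 hsub)

namespace IsTwistedRepresentation

theorem injective (hY : IsTwistedRepresentation β v Y) (x : G) : Function.Injective (Y x) := by
  refine (injective_iff_map_eq_zero (Y x)).2 fun a ha => ?_
  have hβ : β x (star a * a) = 0 := by rw [← hY.star_mul, ha, mul_zero]
  exact (CStarRing.star_mul_self_eq_zero_iff a).1 ((map_eq_zero_iff _ (β x).injective).1 hβ)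

theorem surjective (hY : IsTwistedRepresentation β v Y) (x : G) : Function.Surjective (Y x) := by
  obtain ⟨u, hu⟩ : ∃ u : unitary 𝓜(ℂ, A), ∀ a, Y 1 a = (u : 𝓜(ℂ, A)).snd a := by
    refine ⟨onUnitary (β 1)⁻¹ (v 1 1)⁻¹, fun a => hY.injective 1 ?_⟩
    rw [hY.comp, map_snd_of_star_mul (hY.star_mul 1), ← onUnitary_mul_aut, mul_inv_cancel,
      onUnitary_one_aut, mul_one]
  intro b
  refine ⟨Y x⁻¹ ((star (u : 𝓜(ℂ, A))).snd ((v x x⁻¹ : 𝓜(ℂ, A)).snd b)), ?_⟩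
  rw [hY.comp, mul_inv_cancel, hu, snd_star_mul_cancel, coe_inv_eq_star, snd_mul_star_cancel]

theorem exists_unitary (hY : IsTwistedRepresentation β v Y) (x : G) :
    ∃ w : unitary 𝓜(ℂ, A), ∀ a, (w : 𝓜(ℂ, A)).fst (β x a) = Y x a := by
  obtain ⟨w, hw⟩ := exists_unitary_fst_eq (T := (Y x).comp (autCLM (β x).symm))
    (fun a b => by
      change star (Y x ((β x).symm a)) * Y x ((β x).symm b) = star a * b
      rw [hY.star_mul, ← map_star, ← map_mul, StarAlgEquiv.apply_symm_apply])
    ((hY.surjective x).comp (β x).symm.surjective)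
  exact ⟨w, fun a => (hw _).trans (congrArg (Y x) ((β x).symm_apply_apply a))⟩

end IsTwistedRepresentation

/-- Unitaries `w` whose exterior perturbation `w_x β_x(w_y) v(x, y) w_{xy}⁻¹` of the twisting `v`
is trivial. -/
structure IsUntwisting (β : G → (A ≃⋆ₐ[ℂ] A)) (v : G → G → unitary 𝓜(ℂ, A))
    (w : G → unitary 𝓜(ℂ, A)) : Prop where
  measurable : StrictlyMeasurable w
  map_mul : ∀ x y, w (x * y) = w x * onUnitary (β x) (w y) * v x y

theorem IsTwistedRepresentation.map_mul_of_fst_eq {φ : G → G → G → Circle}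
    (hY : IsTwistedRepresentation β v Y) (h : IsTwistedAction β v φ) {w : G → unitary 𝓜(ℂ, A)}
    (hw : ∀ x a, (w x : 𝓜(ℂ, A)).fst (β x a) = Y x a) (x y : G) :
    w (x * y) = w x * onUnitary (β x) (w y) * v x y := by
  refine unitary_ext fun b => ?_
  obtain ⟨a, rfl⟩ := (β (x * y)).surjective b
  have hv : (v x y : 𝓜(ℂ, A)).fst (β (x * y) a) = (v x y : 𝓜(ℂ, A)).snd (β x (β y a)) := by
    rw [h.action_action, coe_inv_eq_star, snd_star_mul_cancel]
  symm
  calc ((w x * onUnitary (β x) (w y) * v x y : unitary 𝓜(ℂ, A)) : 𝓜(ℂ, A)).fst (β (x * y) a)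
      = (v x y : 𝓜(ℂ, A)).snd ((w x : 𝓜(ℂ, A)).fst (β x ((w y : 𝓜(ℂ, A)).fst (β y a)))) := by
        rw [coe_mul_fst, hv, fst_snd, coe_mul_fst, map_fst]
    _ = (v x y : 𝓜(ℂ, A)).snd (Y x (Y y a)) := by rw [hw, hw]
    _ = Y (x * y) a := by rw [hY.comp, coe_inv_eq_star, snd_star_mul_cancel]
    _ = (w (x * y) : 𝓜(ℂ, A)).fst (β (x * y) a) := (hw _ _).symm

theorem IsTwistedRepresentation.exists_isUntwisting [MeasurableInv G] {φ : G → G → G → Circle}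
    (hY : IsTwistedRepresentation β v Y) (h : IsTwistedAction β v φ) : ∃ w, IsUntwisting β v w := by
  choose w hw using hY.exists_unitary
  have hmul := hY.map_mul_of_fst_eq h hw
  have hw_fst (a : A) : StronglyMeasurable fun x => (w x : 𝓜(ℂ, A)).fst a := by
    have hfst : (fun x => (w x : 𝓜(ℂ, A)).fst a) = fun x => Y x ((β x).symm a) :=
      funext fun x => by rw [← hw, StarAlgEquiv.apply_symm_apply]
    rw [hfst]
    exact stronglyMeasurable_apply (fun x => (Y x).continuous) hY.measurable (h.measurable_symm a)
  refine ⟨w, strictlyMeasurable_of_fst hw_fst fun a => ?_, hmul⟩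
  have hinv (x : G) : (w x)⁻¹ = onUnitary (β x) (w x⁻¹) * v x x⁻¹ * (w 1)⁻¹ := by
    rw [inv_eq_iff_mul_eq_one, ← mul_assoc, ← mul_assoc, ← hmul, mul_inv_cancel, mul_inv_cancel]
  have hfst_inv : (fun x => ((w x)⁻¹.1 : 𝓜(ℂ, A)).fst a) = fun x =>
      β x ((w x⁻¹ : 𝓜(ℂ, A)).fst ((β x).symm ((v x x⁻¹ : 𝓜(ℂ, A)).fst ((w 1)⁻¹.1.fst a)))) :=
    funext fun x => by rw [hinv, coe_mul_fst, coe_mul_fst, onUnitary_fst]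
  rw [hfst_inv]
  have hv : StrictlyMeasurable fun x => v x x⁻¹ :=
    h.measurable_twist.comp (g := fun x => (x, x⁻¹)) (by fun_prop)
  exact stronglyMeasurable_aut_apply h.measurable_action
    (stronglyMeasurable_apply (fun x => (w x⁻¹ : 𝓜(ℂ, A)).fst.continuous)
      (fun a => (hw_fst a).comp_measurable measurable_inv)
      (stronglyMeasurable_aut_apply h.measurable_symm (hv.fst_apply stronglyMeasurable_const)))

theorem IsUntwisting.map_one {w : G → unitary 𝓜(ℂ, A)} {φ : G → G → G → Circle}
    (hw : IsUntwisting β v w) (h : IsTwistedAction β v φ) : w 1 = (v 1 1)⁻¹ := by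
  have hmul := hw.map_mul 1 1
  rw [mul_one, h.action_one, onUnitary_ad, mul_assoc (w 1), inv_mul_cancel_right,
    left_eq_mul] at hmul
  exact eq_inv_of_mul_eq_one_right hmul

end TwistedRepresentation

/-! ### Antisymmetric tricharacters -/

namespace IsAntisymmTricharacter

section

variable {G : Type*} [CommGroup G] [TopologicalSpace G] {φ : G → G → G → Circle}

theorem measurable [TopologicalSpace.MetrizableSpace G] [SecondCountableTopology G]
    [MeasurableSpace G] [OpensMeasurableSpace G] (hφ : IsAntisymmTricharacter φ) :
    Measurable fun p : G × G × G => (φ p.1 p.2.1 p.2.2 : ℂ) := by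
  have hφ_right (x : G) : Measurable fun q : G × G => (φ x q.1 q.2 : ℂ) :=
    measurable_uncurry_of_continuous_of_measurable (u := fun y z => (φ x y z : ℂ))
      (fun z => continuous_subtype_val.comp (hφ.continuous₂ x z))
      fun y => (continuous_subtype_val.comp (hφ.continuous₃ x y)).measurable
  exact measurable_uncurry_of_continuous_of_measurable
    (u := fun x (q : G × G) => (φ x q.1 q.2 : ℂ))
    (fun q => continuous_subtype_val.comp (hφ.continuous₁ q.1 q.2)) hφ_right

theorem cycle (hφ : IsAntisymmTricharacter φ) (x y z : G) : φ x y z = φ y z x := by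
  rw [hφ.swap₂₃ y x z, hφ.swap₁₂ x y z, inv_inv]

theorem map_one₂ (hφ : IsAntisymmTricharacter φ) (x z : G) : φ x 1 z = 1 := by
  simpa only [mul_one, left_eq_mul] using hφ.map_mul₂ x 1 1 z

end

section Product

variable {G₁ G₂ : Type*} [CommGroup G₁] [CommGroup G₂] [TopologicalSpace G₁] [TopologicalSpace G₂]
  {φ : G₁ × G₂ → G₁ × G₂ → G₁ × G₂ → Circle}

theorem eq_one₁₃ (hφ : IsAntisymmTricharacter φ)
    (hφ₂ : ∀ (X Y : G₂) (ζ : G₁ × G₂), φ (1, X) (1, Y) ζ = 1) (X Z : G₂) (η : G₁ × G₂) :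
    φ (1, X) η (1, Z) = 1 := by
  rw [← hφ.cycle (1, Z), hφ₂]

theorem eq_one₂₃ (hφ : IsAntisymmTricharacter φ)
    (hφ₂ : ∀ (X Y : G₂) (ζ : G₁ × G₂), φ (1, X) (1, Y) ζ = 1) (Y Z : G₂) (ξ : G₁ × G₂) :
    φ ξ (1, Y) (1, Z) = 1 := by
  rw [hφ.cycle, hφ₂]

theorem eq_cyclic (hφ : IsAntisymmTricharacter φ)
    (hφ₁ : ∀ x y z : G₁, φ (x, 1) (y, 1) (z, 1) = 1)
    (hφ₂ : ∀ (X Y : G₂) (ζ : G₁ × G₂), φ (1, X) (1, Y) ζ = 1) (ξ η ζ : G₁ × G₂) :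
    φ ξ η ζ = φ (1, ξ.2) (η.1, 1) (ζ.1, 1) * φ (1, η.2) (ζ.1, 1) (ξ.1, 1) *
        φ (1, ζ.2) (ξ.1, 1) (η.1, 1) := by
  conv_lhs => rw [← ξ.fst_mul_snd, ← η.fst_mul_snd, ← ζ.fst_mul_snd]
  simp only [hφ.map_mul₁, hφ.map_mul₂, hφ.map_mul₃, hφ₁, hφ₂, hφ.eq_one₁₃ hφ₂,
    hφ.eq_one₂₃ hφ₂, one_mul, mul_one]
  rw [hφ.cycle (ξ.1, 1) (1, η.2), ← hφ.cycle (1, ζ.2), mul_comm, mul_assoc,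
    mul_comm (φ (1, ζ.2) _ _)]

end Product

end IsAntisymmTricharacter

section HatCochain

variable {G₁ G₂ : Type*} [CommGroup G₁] [CommGroup G₂]
  {φ : G₁ × G₂ → G₁ × G₂ → G₁ × G₂ → Circle}

variable (φ) in
/-- The two-cochain `c` for which the twisting `v̂` is the exterior perturbation of `v` by the
unitaries `w_{xX} = v(x, X)`, multiplied by `c`. -/
def hatCochain (ξ η : G₁ × G₂) : Circle :=
  φ (ξ.1, 1) (η.1, 1) (1, ξ.2 * η.2) / φ (ξ.1, 1) (1, ξ.2) η

variable [TopologicalSpace G₁] [TopologicalSpace G₂]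

theorem measurable_hatCochain [MeasurableSpace G₁] [MeasurableSpace G₂]
    [TopologicalSpace.MetrizableSpace G₁] [SecondCountableTopology G₁] [OpensMeasurableSpace G₁]
    [TopologicalSpace.MetrizableSpace G₂] [SecondCountableTopology G₂] [OpensMeasurableSpace G₂]
    [MeasurableMul₂ G₂] (hφ : IsAntisymmTricharacter φ) :
    Measurable fun p : (G₁ × G₂) × (G₁ × G₂) => (hatCochain φ p.1 p.2 : ℂ) := by
  simp only [hatCochain, Circle.coe_div]
  exact .div
    (hφ.measurable.comp (f := fun p : (G₁ × G₂) × (G₁ × G₂) =>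
      (((p.1.1, 1) : G₁ × G₂), ((p.2.1, 1) : G₁ × G₂), ((1, p.1.2 * p.2.2) : G₁ × G₂)))
      (by fun_prop))
    (hφ.measurable.comp (f := fun p : (G₁ × G₂) × (G₁ × G₂) =>
      (((p.1.1, 1) : G₁ × G₂), ((1, p.1.2) : G₁ × G₂), p.2)) (by fun_prop))

theorem hatCochain_eq (hφ : IsAntisymmTricharacter φ)
    (hφ₂ : ∀ (X Y : G₂) (ζ : G₁ × G₂), φ (1, X) (1, Y) ζ = 1) (ξ η : G₁ × G₂) :
    hatCochain φ ξ η =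
      φ (1, ξ.2) (ξ.1, 1) (η.1, 1) ^ 2 * φ (1, η.2) (ξ.1, 1) (η.1, 1) := by
  have hdenom : φ (ξ.1, 1) (1, ξ.2) η = (φ (1, ξ.2) (ξ.1, 1) (η.1, 1))⁻¹ := by
    rw [← Prod.fst_mul_snd η, hφ.map_mul₃, hφ.cycle _ _ (1, η.2), hφ₂, mul_one, hφ.swap₁₂,
      Prod.fst_mul_snd]
  rw [hatCochain, hdenom, div_inv_eq_mul, ← hφ.cycle (1, _), ← Prod.one_mk_mul_one_mk,
    hφ.map_mul₁, sq, mul_right_comm]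

theorem hatCocycle_eq_mul_coboundary (hφ : IsAntisymmTricharacter φ)
    (hφ₁ : ∀ x y z : G₁, φ (x, 1) (y, 1) (z, 1) = 1)
    (hφ₂ : ∀ (X Y : G₂) (ζ : G₁ × G₂), φ (1, X) (1, Y) ζ = 1) (ξ η ζ : G₁ × G₂) :
    hatCocycle φ ξ η ζ = φ ξ η ζ * coboundary (hatCochain φ) ξ η ζ := by
  rw [hatCocycle, hφ.eq_cyclic hφ₁ hφ₂ ξ η ζ, coboundary]
  simp only [hatCochain_eq hφ hφ₂, Prod.fst_mul, Prod.snd_mul,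
    ← Prod.mk_one_mul_mk_one, ← Prod.one_mk_mul_one_mk, hφ.map_mul₁, hφ.map_mul₂,
    hφ.map_mul₃, hφ.swap₂₃ (1, η.2) (ξ.1, 1) (ζ.1, 1)]
  refine Circle.ext ?_
  push_cast
  field_simp

end HatCochain

/-! ### Twisted actions of a product of two groups -/

section Untwisting

variable {A : Type*} [NonUnitalCStarAlgebra A]

theorem IsStable.exists_isUntwisting {G : Type*} [CommGroup G] [TopologicalSpace G]
    [IsTopologicalGroup G] [LocallyCompactSpace G] [SecondCountableTopology G]
    [MeasurableSpace G] [BorelSpace G] {β : G → (A ≃⋆ₐ[ℂ] A)} {v : G → G → unitary 𝓜(ℂ, A)}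
    (hA : IsStable A) (h : IsTwistedAction β v 1) : ∃ w, IsUntwisting β v w := by
  obtain ⟨Y, hY⟩ := hA.exists_isTwistedRepresentation h Measure.haar
  exact hY.exists_isUntwisting h

variable {G₁ G₂ : Type*} [CommGroup G₁] [CommGroup G₂] [MeasurableSpace G₁] [MeasurableSpace G₂]
  {β : G₁ × G₂ → (A ≃⋆ₐ[ℂ] A)} {v : G₁ × G₂ → G₁ × G₂ → unitary 𝓜(ℂ, A)}
  {φ : G₁ × G₂ → G₁ × G₂ → G₁ × G₂ → Circle}

namespace IsTwistedAction

theorem comp_inl (h : IsTwistedAction β v φ) :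
    IsTwistedAction (fun x : G₁ => β (x, 1)) (fun x y => v (x, 1) (y, 1))
      fun x y z => φ (x, 1) (y, 1) (z, 1) :=
  h.comp_hom (MonoidHom.inl G₁ G₂) measurable_prodMk_right

theorem comp_inr (h : IsTwistedAction β v φ) :
    IsTwistedAction (fun X : G₂ => β (1, X)) (fun X Y => v (1, X) (1, Y))
      fun X Y Z => φ (1, X) (1, Y) (1, Z) :=
  h.comp_hom (MonoidHom.inr G₁ G₂) measurable_prodMk_left

theorem exists_trivialOnFactors (h : IsTwistedAction β v φ) {w₁ : G₁ → unitary 𝓜(ℂ, A)}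
    {w₂ : G₂ → unitary 𝓜(ℂ, A)}
    (hw₁ : IsUntwisting (fun x => β (x, 1)) (fun x y => v (x, 1) (y, 1)) w₁)
    (hw₂ : IsUntwisting (fun X => β (1, X)) (fun X Y => v (1, X) (1, Y)) w₂) :
    ∃ β' v', ExteriorEquivalent β v β' v' ∧ TrivialOnFactors v' := by
  have hone : w₁ 1 = w₂ 1 := (hw₁.map_one h.comp_inl).trans (hw₂.map_one h.comp_inr).symm
  let w (ξ : G₁ × G₂) : unitary 𝓜(ℂ, A) := w₁ ξ.1 * (w₁ 1)⁻¹ * w₂ ξ.2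
  have hw : StrictlyMeasurable w :=
    ((hw₁.measurable.comp measurable_fst).mul (.const _)).mul (hw₂.measurable.comp measurable_snd)
  have hw_inl (x : G₁) : w (x, 1) = w₁ x := by simp only [w, ← hone, inv_mul_cancel_right]
  have hw_inr (X : G₂) : w (1, X) = w₂ X := by simp only [w, mul_inv_cancel, one_mul]
  refine ⟨fun ξ => ad (w ξ) * β ξ,
    fun ξ η => w ξ * onUnitary (β ξ) (w η) * v ξ η * (w (ξ * η))⁻¹,
    ⟨w, hw, fun _ => rfl, fun _ _ => rfl⟩, fun x y => ?_, fun X Y => ?_⟩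
  · beta_reduce
    rw [Prod.mk_one_mul_mk_one, hw_inl, hw_inl, hw_inl, ← hw₁.map_mul, mul_inv_cancel]
  · beta_reduce
    rw [Prod.one_mk_mul_one_mk, hw_inr, hw_inr, hw_inr, ← hw₂.map_mul, mul_inv_cancel]

end IsTwistedAction

theorem IsStable.exists_trivialOnFactors
    [TopologicalSpace G₁] [IsTopologicalGroup G₁] [LocallyCompactSpace G₁]
    [SecondCountableTopology G₁] [BorelSpace G₁]
    [TopologicalSpace G₂] [IsTopologicalGroup G₂] [LocallyCompactSpace G₂]
    [SecondCountableTopology G₂] [BorelSpace G₂]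
    (hA : IsStable A) (h : IsTwistedAction β v φ)
    (hφ₁ : ∀ x y z : G₁, φ (x, 1) (y, 1) (z, 1) = 1)
    (hφ₂ : ∀ X Y Z : G₂, φ (1, X) (1, Y) (1, Z) = 1) :
    ∃ β' v', IsTwistedAction β' v' φ ∧ ExteriorEquivalent β v β' v' ∧ TrivialOnFactors v' := by
  have h₁ : IsTwistedAction (fun x : G₁ => β (x, 1)) (fun x y => v (x, 1) (y, 1)) 1 := by
    simpa only [hφ₁] using! h.comp_inl
  have h₂ : IsTwistedAction (fun X : G₂ => β (1, X)) (fun X Y => v (1, X) (1, Y)) 1 := by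
    simpa only [hφ₂] using! h.comp_inr
  obtain ⟨w₁, hw₁⟩ := hA.exists_isUntwisting h₁
  obtain ⟨w₂, hw₂⟩ := hA.exists_isUntwisting h₂
  obtain ⟨β', v', hext, hv'⟩ := h.exists_trivialOnFactors hw₁ hw₂
  exact ⟨β', v', hext.isTwistedAction h, hext, hv'⟩

end Untwisting

section HatAction

variable {G₁ G₂ A : Type*} [CommGroup G₁] [CommGroup G₂] [NonUnitalCStarAlgebra A]
  {β : G₁ × G₂ → (A ≃⋆ₐ[ℂ] A)} {v : G₁ × G₂ → G₁ × G₂ → unitary 𝓜(ℂ, A)}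
  {φ : G₁ × G₂ → G₁ × G₂ → G₁ × G₂ → Circle}

namespace TrivialOnFactors

theorem tildeTwist_one_left (hv : TrivialOnFactors v) (y : G₁) :
    tildeTwist v 1 y = 1 := by
  rw [tildeTwist, hv.1, hv.1, inv_one, one_mul]

theorem tildeTwist_one_right (hv : TrivialOnFactors v) (X : G₂) :
    tildeTwist v X 1 = 1 := by
  rw [tildeTwist, hv.2, hv.2, inv_one, one_mul]

theorem action_one [MeasurableSpace G₁] [MeasurableSpace G₂] (hv : TrivialOnFactors v)
    (h : IsTwistedAction β v φ) : β 1 = 1 := by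
  rw [h.action_one, ← Prod.mk_one_one, hv.1, ad_one]

end TrivialOnFactors

variable [MeasurableSpace G₁] [MeasurableSpace G₂]

namespace IsTwistedAction

theorem hatAction_eq (h : IsTwistedAction β v φ) (ξ : G₁ × G₂) :
    hatAction β ξ = ad (v (ξ.1, 1) (1, ξ.2)) * β ξ := by
  rw [hatAction, h.comp, Prod.fst_mul_snd]

theorem onUnitary_mul_eq_tildeTwist_mul (h : IsTwistedAction β v φ) (hv : TrivialOnFactors v)
    (hφ₁₃ : ∀ (X Z : G₂) (η : G₁ × G₂), φ (1, X) η (1, Z) = 1)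
    (hφ₂₃ : ∀ (Y Z : G₂) (ξ : G₁ × G₂), φ ξ (1, Y) (1, Z) = 1) (X Y : G₂) (y : G₁) :
    onUnitary (β (1, X)) (v (y, 1) (1, Y)) * v (1, X) (y, Y) =
      tildeTwist v X y * v (y, 1) (1, X * Y) := by
  have hXyY := h.cocycle_eq (1, X) (y, 1) (1, Y)
  have hyXY := h.cocycle_eq (y, 1) (1, X) (1, Y)
  simp only [hφ₁₃, hφ₂₃, hv.2, Prod.mk_mul_mk, mul_one, one_mul, map_one] at hXyY hyXY
  rw [← hXyY, tildeTwist, ← hyXY, mul_assoc, inv_mul_cancel_left]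

theorem scalar_mul_onUnitary_mul (h : IsTwistedAction β v φ) (hv : TrivialOnFactors v)
    (x y : G₁) (X : G₂) :
    scalar (φ (x, 1) (y, 1) (1, X)) *
        (onUnitary (β (x, 1)) (v (y, 1) (1, X)) * v (x, 1) (y, X)) =
      v (x * y, 1) (1, X) := by
  simpa only [hv.1, Prod.mk_mul_mk, mul_one, one_mul] using
    (h.cocycle_eq (x, 1) (y, 1) (1, X)).symm

theorem hatTwist_eq (h : IsTwistedAction β v φ) (hv : TrivialOnFactors v)
    (hφ₁₃ : ∀ (X Z : G₂) (η : G₁ × G₂), φ (1, X) η (1, Z) = 1)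
    (hφ₂₃ : ∀ (Y Z : G₂) (ξ : G₁ × G₂), φ ξ (1, Y) (1, Z) = 1) (ξ η : G₁ × G₂) :
    hatTwist β v ξ η = scalar (hatCochain φ ξ η) *
      (v (ξ.1, 1) (1, ξ.2) * onUnitary (β ξ) (v (η.1, 1) (1, η.2)) * v ξ η *
        (v ((ξ * η).1, 1) (1, (ξ * η).2))⁻¹) := by
  obtain ⟨x, X⟩ := ξ
  obtain ⟨y, Y⟩ := η
  have hmul := h.mul_onUnitary_mul (x, 1) (1, X) (y, Y) (v (y, 1) (1, Y))
  simp only [Prod.mk_mul_mk, one_mul, mul_one] at hmul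
  rw [h.onUnitary_mul_eq_tildeTwist_mul hv hφ₁₃ hφ₂₃, map_mul, mul_assoc (onUnitary _ _)] at hmul
  rw [hatTwist, hatCochain, ← mul_assoc, eq_mul_inv_iff_mul_eq, Prod.mk_mul_mk, hmul,
    ← h.scalar_mul_onUnitary_mul hv, mul_scalar_mul, ← mul_assoc (scalar _) (scalar _), ← map_mul,
    div_mul_cancel]

theorem exteriorEquivalentUpToScalars_hat
    [TopologicalSpace G₁] [TopologicalSpace.MetrizableSpace G₁] [SecondCountableTopology G₁]
    [OpensMeasurableSpace G₁] [TopologicalSpace G₂] [TopologicalSpace.MetrizableSpace G₂]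
    [SecondCountableTopology G₂] [OpensMeasurableSpace G₂] [MeasurableMul₂ G₂]
    (h : IsTwistedAction β v φ) (hv : TrivialOnFactors v)
    (hφ : IsAntisymmTricharacter φ) (hφ₁ : ∀ x y z : G₁, φ (x, 1) (y, 1) (z, 1) = 1)
    (hφ₂ : ∀ (X Y : G₂) (ζ : G₁ × G₂), φ (1, X) (1, Y) ζ = 1) :
    ExteriorEquivalentUpToScalars β v φ (hatAction β) (hatTwist β v) (hatCocycle φ) := by
  have hw : StrictlyMeasurable fun ξ : G₁ × G₂ => v (ξ.1, 1) (1, ξ.2) :=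
    h.measurable_twist.comp (g := fun ξ : G₁ × G₂ => ((ξ.1, 1), (1, ξ.2))) (by fun_prop)
  exact ⟨_, hatCochain φ, hw, measurable_hatCochain hφ, h.hatAction_eq,
    fun ξ η => eq_scalar_mul_iff.1 (h.hatTwist_eq hv (hφ.eq_one₁₃ hφ₂) (hφ.eq_one₂₃ hφ₂) ξ η),
    hatCocycle_eq_mul_coboundary hφ hφ₁ hφ₂⟩

theorem tildeTwist_mul_left (h : IsTwistedAction β v φ) (hv : TrivialOnFactors v)
    (hhat : IsTwistedAction (hatAction β) (hatTwist β v) (hatCocycle φ))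
    (hφ : ∀ ξ ζ, φ ξ 1 ζ = 1) (X Y : G₂) (z : G₁) :
    tildeTwist v (X * Y) z =
      onUnitary (β (1, X)) (tildeTwist v Y z) * tildeTwist v X z := by
  have hcocycle := hhat.cocycle_eq (1, X) (1, Y) (z, 1)
  simpa only [hatTwist, hatAction, hatCocycle, Prod.mk_one_one, Prod.mk_mul_mk, one_mul,
    mul_one, hv.action_one h, hv.tildeTwist_one_right, onUnitary_one_aut, hφ, one_pow,
    map_one] using hcocycle

theorem tildeTwist_mul_right (h : IsTwistedAction β v φ) (hv : TrivialOnFactors v)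
    (hhat : IsTwistedAction (hatAction β) (hatTwist β v) (hatCocycle φ)) (X : G₂) (y z : G₁) :
    tildeTwist v X (y * z) = scalar ((φ (1, X) (y, 1) (z, 1))⁻¹ ^ 3) *
      (tildeTwist v X y * onUnitary (β (y, 1)) (tildeTwist v X z)) := by
  have hcocycle := hhat.cocycle_eq (1, X) (y, 1) (z, 1)
  simp only [hatTwist, hatAction, hatCocycle, Prod.mk_one_one, Prod.mk_mul_mk, one_mul,
    mul_one, hv.action_one h, hv.tildeTwist_one_left, onUnitary_one_aut, map_one] at hcocycle
  rw [hcocycle, inv_pow, ← mul_assoc, ← map_mul, inv_mul_cancel, map_one, one_mul]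

end IsTwistedAction

end HatAction

end TwistedAction

end

theorem mainTheorem4_general
    {G₁ G₂ A : Type*}
    [CommGroup G₁] [TopologicalSpace G₁] [IsTopologicalGroup G₁] [T2Space G₁]
    [LocallyCompactSpace G₁] [SecondCountableTopology G₁] [MeasurableSpace G₁] [BorelSpace G₁]
    [CommGroup G₂] [TopologicalSpace G₂] [IsTopologicalGroup G₂] [T2Space G₂]
    [LocallyCompactSpace G₂] [SecondCountableTopology G₂] [MeasurableSpace G₂] [BorelSpace G₂]
    [NonUnitalCStarAlgebra A] (hA : IsStable A)
    (φ : G₁ × G₂ → G₁ × G₂ → G₁ × G₂ → Circle) (hφ : IsAntisymmTricharacter φ)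
    (hφ₁ : ∀ x y z : G₁, φ (x, 1) (y, 1) (z, 1) = 1)
    (hφ₂ : ∀ (X Y : G₂) (ζ : G₁ × G₂), φ (1, X) (1, Y) ζ = 1)
    (β : G₁ × G₂ → (A ≃⋆ₐ[ℂ] A)) (v : G₁ × G₂ → G₁ × G₂ → unitary 𝓜(ℂ, A))
    (hβ : IsTwistedAction β v φ) :
    (∃ (β' : G₁ × G₂ → (A ≃⋆ₐ[ℂ] A)) (v' : G₁ × G₂ → G₁ × G₂ → unitary 𝓜(ℂ, A)),
      IsTwistedAction β' v' φ ∧ ExteriorEquivalent β v β' v' ∧ TrivialOnFactors v') ∧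
    (∀ (β' : G₁ × G₂ → (A ≃⋆ₐ[ℂ] A)) (v' : G₁ × G₂ → G₁ × G₂ → unitary 𝓜(ℂ, A)),
      IsTwistedAction β' v' φ → ExteriorEquivalent β v β' v' → TrivialOnFactors v' →
        IsTwistedAction (hatAction β') (hatTwist β' v') (hatCocycle φ) ∧
        ExteriorEquivalentUpToScalars β' v' φ
          (hatAction β') (hatTwist β' v') (hatCocycle φ) ∧
        ExteriorEquivalentUpToScalars β v φ
          (hatAction β') (hatTwist β' v') (hatCocycle φ) ∧
        (∀ (X Y : G₂) (z : G₁), tildeTwist v' (X * Y) z =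
          onUnitary (β' (1, X)) (tildeTwist v' Y z) * tildeTwist v' X z) ∧
        (∀ (X : G₂) (y z : G₁), (tildeTwist v' X (y * z) : 𝓜(ℂ, A)) =
          (((φ (1, X) (y, 1) (z, 1))⁻¹ ^ 3 : Circle) : ℂ) •
            ((tildeTwist v' X y * onUnitary (β' (y, 1)) (tildeTwist v' X z) :
              unitary 𝓜(ℂ, A)) : 𝓜(ℂ, A)))) ∧
    (∀ ξ η ζ : G₁ × G₂,
      φ ξ η ζ ^ 3 = hatCocycle φ ξ η ζ * hatCocycle φ η ζ ξ * hatCocycle φ ζ ξ η ∧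
      φ ξ η ζ = φ (1, ξ.2) (η.1, 1) (ζ.1, 1) * φ (1, η.2) (ζ.1, 1) (ξ.1, 1) *
        φ (1, ζ.2) (ξ.1, 1) (η.1, 1)) := by
  have hcyclic := hφ.eq_cyclic hφ₁ hφ₂
  refine ⟨hA.exists_trivialOnFactors hβ hφ₁ fun X Y Z => hφ₂ X Y _,
    fun β' v' hβ' hext hv' => ?_, fun ξ η ζ => ⟨?_, hcyclic ξ η ζ⟩⟩
  · have hequiv := hβ'.exteriorEquivalentUpToScalars_hat hv' hφ hφ₁ hφ₂
    have hhat := hequiv.isTwistedAction hβ'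
    exact ⟨hhat, hequiv, hext.trans_upToScalars hequiv,
      hβ'.tildeTwist_mul_left hv' hhat hφ.map_one₂,
      fun X y z => eq_scalar_mul_iff.1 (hβ'.tildeTwist_mul_right hv' hhat X y z)⟩
  · rw [hcyclic, mul_pow, mul_pow, hatCocycle, hatCocycle, hatCocycle]

theorem mainTheorem4
    {G₁ G₂ A : Type*}
    [CommGroup G₁] [TopologicalSpace G₁] [IsTopologicalGroup G₁] [T2Space G₁]
    [LocallyCompactSpace G₁] [SecondCountableTopology G₁] [MeasurableSpace G₁] [BorelSpace G₁]
    [CommGroup G₂] [TopologicalSpace G₂] [IsTopologicalGroup G₂] [T2Space G₂]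
    [LocallyCompactSpace G₂] [SecondCountableTopology G₂] [MeasurableSpace G₂] [BorelSpace G₂]
    [NonUnitalCStarAlgebra A] (hA : IsStable A)
    (hG₁ : MooreH3Trivial G₁) (hG₂ : MooreH3Trivial G₂)
    (φ : G₁ × G₂ → G₁ × G₂ → G₁ × G₂ → Circle) (hφ : IsAntisymmTricharacter φ)
    (hφ₁ : ∀ x y z : G₁, φ (x, 1) (y, 1) (z, 1) = 1)
    (hφ₂ : ∀ (X Y : G₂) (ζ : G₁ × G₂),
      φ (1, X) (1, Y) ζ = 1 ∧ φ (1, X) ζ (1, Y) = 1 ∧ φ ζ (1, X) (1, Y) = 1)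
    (β : G₁ × G₂ → (A ≃⋆ₐ[ℂ] A)) (v : G₁ × G₂ → G₁ × G₂ → unitary 𝓜(ℂ, A))
    (hβ : IsTwistedAction β v φ) :
    -- `v` may be taken to be trivial on the subgroups
    (∃ (β' : G₁ × G₂ → (A ≃⋆ₐ[ℂ] A)) (v' : G₁ × G₂ → G₁ × G₂ → unitary 𝓜(ℂ, A)),
      IsTwistedAction β' v' φ ∧ ExteriorEquivalent β v β' v' ∧ TrivialOnFactors v') ∧
    -- and, however this is done, the remaining assertions hold
    (∀ (β' : G₁ × G₂ → (A ≃⋆ₐ[ℂ] A)) (v' : G₁ × G₂ → G₁ × G₂ → unitary 𝓜(ℂ, A)),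
      IsTwistedAction β' v' φ → ExteriorEquivalent β v β' v' → TrivialOnFactors v' →
        IsTwistedAction (hatAction β') (hatTwist β' v') (hatCocycle φ) ∧
        ExteriorEquivalentUpToScalars β' v' φ
          (hatAction β') (hatTwist β' v') (hatCocycle φ) ∧
        ExteriorEquivalentUpToScalars β v φ
          (hatAction β') (hatTwist β' v') (hatCocycle φ) ∧
        (∀ (X Y : G₂) (z : G₁), tildeTwist v' (X * Y) z =
          onUnitary (β' (1, X)) (tildeTwist v' Y z) * tildeTwist v' X z) ∧
        (∀ (X : G₂) (y z : G₁), (tildeTwist v' X (y * z) : 𝓜(ℂ, A)) =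
          (((φ (1, X) (y, 1) (z, 1))⁻¹ ^ 3 : Circle) : ℂ) •
            ((tildeTwist v' X y * onUnitary (β' (y, 1)) (tildeTwist v' X z) :
              unitary 𝓜(ℂ, A)) : 𝓜(ℂ, A)))) ∧
    -- the three-cocycle of `v̂` has antisymmetrisation `φ`
    (∀ ξ η ζ : G₁ × G₂,
      φ ξ η ζ ^ 3 = hatCocycle φ ξ η ζ * hatCocycle φ η ζ ξ * hatCocycle φ ζ ξ η ∧
      φ ξ η ζ = φ (1, ξ.2) (η.1, 1) (ζ.1, 1) * φ (1, η.2) (ζ.1, 1) (ξ.1, 1) *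
        φ (1, ζ.2) (ξ.1, 1) (η.1, 1)) :=
  mainTheorem4_general hA φ hφ hφ₁ (fun X Y ζ => (hφ₂ X Y ζ).1) β v hβ
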